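/- Let $d\in\mathbb N$ and, for $k\in\mathbb Z^d$, $\|k\|_1=\sum_r|k_r|$. Let $u:\mathbb Z^d\to\mathbb R$ be a function that is not identically zero (its sign may change arbitrarily) and for which there are constants $C,\alpha>0$ with $$|u(k)|\le C e^{-\alpha\|k\|_1}\qquad\text{for all }k\in\mathbb Z^d. \tag{1}$$ For $\omega=(\omega_k)_{k\in\mathbb Z^d}$ let $h_\omega=h_0+v_\omega$ on $\ell^2(\mathbb Z^d)$, where $(h_0\psi)(x)=\sum_{\|x-y\|_1=1}(\psi(x)-\psi(y))$ and $v_\omega$ is multiplication by $v_\omega(x)=\sum_{k\in\mathbb Z^d}\omega_k u(x-k)$. For $l\ge 0$ put $\Lambda_l=[-l,l]^d\cap\mathbb Z^d$, and let $h_\omega^l=\pi_{\Lambda_l}h_\omega\iota_{\Lambda_l}$ be the restriction of $h_\omega$ to $\ell^2(\Lambda_l)$, where $\iota_{\Lambda_l}:\ell^2(\Lambda_l)\to\ell^2(\mathbb Z^d)$ is the inclusion and $\pi_{\Lambda_l}$ its adjoint. Let $P_I(h_\omega^l)$ denote the spectral projection of $h_\omega^l$ for the set $I\subset\mathbb R$.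 Let $F(z)=\sum_{k\in\mathbb Z^d}u(-k)z^k$, which is holomorphic near $\mathbf 1=(1,\dots,1)\in\mathbb C^d$. Call $I_0\in\mathbb N_0^d$ a leading index of $u$ if $(D^{I_0}_zF)(\mathbf 1)\ne0$ and $(D^{J}_zF)(\mathbf 1)=0$ for all $J\in\mathbb N_0^d$ with $J\le I_0$ componentwise and $J\neq I_0$. For such an $I_0$ put $c_u=(D^{I_0}_zF)(\mathbf 1)$, $N=\|I_0\|_1$ and, for $l>0$, $$R_l=\max\Bigl\{2l+\frac2\alpha\ln\frac{2\cdot3^d\,C}{|c_u|(1-e^{-\alpha/2})},\ \frac{8(d+N)^2}{\alpha^2}\Bigr\}.$$ Then $u$ has a leading index, and there is a constant $C_W>0$, depending only on $u$, with the following property. Let $C,\alpha>0$ be any constants satisfying (1), let $I_0$ be any leading index of $u$, and let $\mu$ be any probability measure on $\mathbb R$ with bounded support and a density $\rho\in BV(\mathbb R)$, that is, $\rho\in L^1(\mathbb R)$ and the distributional derivative of $\rho$ is a finite signed measure. Then for every $l>0$ and every bounded interval $I\subset\mathbb R$ we have, with $\Gamma=\Lambda_{R_l}$, $$\mathbb E_\Gamma\bigl\{\operatorname{Tr}P_I(h_\omega^l)\bigr\}\le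 C_W\,\|\rho\|_{\rm Var}\,|I|\,(2l+1)^{2d+N}.$$ Here $\|\rho\|_{\rm Var}=\sup\{\int_{\mathbb R}\rho v'\,dx: v\in C_c^\infty(\mathbb R),\ |v|\le1\}$, $|I|$ is the length of $I$, and $\mathbb E_\Gamma$ is the integral over $(\omega_k)_{k\in\Gamma}$ with respect to $\prod_{k\in\Gamma}\mu(d\omega_k)$, while the couplings $(\omega_k)_{k\notin\Gamma}$ are fixed, arbitrary real numbers for which all the series $v_\omega(x)$, $x\in\mathbb Z^d$, converge absolutely (for instance any bounded family, hence any family in $\operatorname{supp}\mu$). -/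

import Mathlib

open MeasureTheory

noncomputable section

namespace AlloyWegner

/-- The `ℓ¹`-norm `‖k‖₁ = ∑ᵣ |kᵣ|` of a lattice point. -/
def l1norm {d : ℕ} (k : Fin d → ℤ) : ℤ := ∑ i, |k i|

/-- The box `[-l, l]^d ∩ ℤ^d`, see `mem_box`. -/
def box (d : ℕ) (l : ℝ) : Finset (Fin d → ℤ) :=
  Fintype.piFinset fun _ => Finset.Icc ⌈-l⌉ ⌊l⌋

theorem mem_box {d : ℕ} {l : ℝ} {k : Fin d → ℤ} :
    k ∈ box d l ↔ ∀ i, (k i : ℝ) ∈ Set.Icc (-l) l := by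
  simp [box, Int.ceil_le, Int.le_floor]

/-- The nearest neighbours of `x` in `ℤ^d`, see `mem_neighbors`. -/
def neighbors {d : ℕ} (x : Fin d → ℤ) : Finset (Fin d → ℤ) :=
  (Fintype.piFinset fun i => Finset.Icc (x i - 1) (x i + 1)).filter fun y => l1norm (x - y) = 1

theorem mem_neighbors {d : ℕ} {x y : Fin d → ℤ} : y ∈ neighbors x ↔ l1norm (x - y) = 1 := by
  simp only [neighbors, Finset.mem_filter, Fintype.mem_piFinset, Finset.mem_Icc,
    and_iff_right_iff_imp]
  intro h i
  have hi : |(x - y) i| ≤ 1 := by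
    rw [← h]
    exact Finset.single_le_sum (f := fun j => |(x - y) j|) (fun j _ => abs_nonneg _)
      (Finset.mem_univ i)
  rw [Pi.sub_apply, abs_le] at hi
  omega

/-- The negative discrete Laplacian `(h₀ ψ)(x) = ∑_{‖x - y‖₁ = 1} (ψ x - ψ y)`. -/
def laplacian (d : ℕ) : ((Fin d → ℤ) → ℂ) →ₗ[ℂ] ((Fin d → ℤ) → ℂ) where
  toFun ψ x := ∑ y ∈ neighbors x, (ψ x - ψ y)
  map_add' ψ φ := by
    funext x
    simp only [Pi.add_apply, ← Finset.sum_add_distrib]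
    exact Finset.sum_congr rfl fun y _ => by ring
  map_smul' c ψ := by
    funext x
    simp only [Pi.smul_apply, smul_eq_mul, RingHom.id_apply, Finset.mul_sum]
    exact Finset.sum_congr rfl fun y _ => by ring

/-- The alloy-type potential `v_ω(x) = ∑ₖ ω_k u(x - k)`. -/
def potential {d : ℕ} (u ω : (Fin d → ℤ) → ℝ) (x : Fin d → ℤ) : ℝ := ∑' k, ω k * u (x - k)

/-- The operator `h_ω = h₀ + v_ω`, as a map on functions on `ℤ^d`. -/
def hamiltonian {d : ℕ} (u ω : (Fin d → ℤ) → ℝ) :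
    ((Fin d → ℤ) → ℂ) →ₗ[ℂ] ((Fin d → ℤ) → ℂ) where
  toFun ψ x := laplacian d ψ x + (potential u ω x : ℂ) * ψ x
  map_add' ψ φ := by
    funext x
    simp only [map_add, Pi.add_apply]
    ring
  map_smul' c ψ := by
    funext x
    simp only [map_smul, Pi.smul_apply, smul_eq_mul, RingHom.id_apply]
    ring

/-- The inclusion `ι_Λ` of `ℓ²(Λ)`: extension by zero. -/
def inclusion {d : ℕ} (Λ : Finset (Fin d → ℤ)) :
    EuclideanSpace ℂ Λ →ₗ[ℂ] ((Fin d → ℤ) → ℂ) where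
  toFun ψ x := if hx : x ∈ Λ then ψ ⟨x, hx⟩ else 0
  map_add' ψ φ := by
    funext x
    by_cases hx : x ∈ Λ <;> simp [hx]
  map_smul' c ψ := by
    funext x
    by_cases hx : x ∈ Λ <;> simp [hx]

/-- The restriction `π_Λ` to `Λ`. -/
def restriction {d : ℕ} (Λ : Finset (Fin d → ℤ)) :
    ((Fin d → ℤ) → ℂ) →ₗ[ℂ] EuclideanSpace ℂ Λ where
  toFun ψ := WithLp.toLp 2 fun x => ψ x
  map_add' _ _ := rfl
  map_smul' _ _ := rfl

/-- The finite volume operator `h_ω^Λ = π_Λ h_ω ι_Λ` on `ℓ²(Λ)`. -/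
def boxHamiltonian {d : ℕ} (u ω : (Fin d → ℤ) → ℝ) (Λ : Finset (Fin d → ℤ)) :
    EuclideanSpace ℂ Λ →ₗ[ℂ] EuclideanSpace ℂ Λ :=
  restriction Λ ∘ₗ hamiltonian u ω ∘ₗ inclusion Λ

/-- The spectral projection `P_B(T)` of a self-adjoint operator `T` on a finite-dimensional Hilbert
space: the orthogonal projection onto the span of the eigenspaces with eigenvalues in `B`. -/
def spectralProjection {E : Type*} [NormedAddCommGroup E] [InnerProductSpace ℂ E]
    [FiniteDimensional ℂ E] (T : E →ₗ[ℂ] E) (B : Set ℝ) : E →ₗ[ℂ] E :=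
  (⨆ e ∈ B, Module.End.eigenspace T (e : ℂ)).starProjection

/-- `Tr P_B(h_ω^Λ)`. -/
def traceProj {d : ℕ} (u ω : (Fin d → ℤ) → ℝ) (Λ : Finset (Fin d → ℤ)) (B : Set ℝ) : ℝ :=
  (LinearMap.trace ℂ _ (spectralProjection (boxHamiltonian u ω Λ) B)).re

/-- The configuration which is `η` on `Γ` and `ω` outside `Γ`. -/
def glue {d : ℕ} (Γ : Finset (Fin d → ℤ)) (η : Γ → ℝ) (ω : (Fin d → ℤ) → ℝ) :
    (Fin d → ℤ) → ℝ :=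
  fun k => if hk : k ∈ Γ then η ⟨k, hk⟩ else ω k

/-- Exponential decay with constants `C, α > 0`. -/
def ExpDecay {d : ℕ} (u : (Fin d → ℤ) → ℝ) (C α : ℝ) : Prop :=
  0 < C ∧ 0 < α ∧ ∀ k, |u k| ≤ C * Real.exp (-α * l1norm k)

/-- The generating function `F(z) = ∑ₖ u(-k) z^k`, whose series converges absolutely near
`(1, …, 1)` if `u` decays exponentially. -/
def genFun {d : ℕ} (u : (Fin d → ℤ) → ℝ) (z : Fin d → ℂ) : ℂ :=
  ∑' k : Fin d → ℤ, (u (-k) : ℂ) * ∏ i, z i ^ k i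

/-- The complex partial derivative `∂f/∂zᵢ`. -/
def partialDeriv {d : ℕ} (i : Fin d) (f : (Fin d → ℂ) → ℂ) (z : Fin d → ℂ) : ℂ :=
  deriv (fun w => f (Function.update z i w)) (z i)

/-- `D^I f = (∂/∂z₁)^{i₁} ⋯ (∂/∂z_d)^{i_d} f`. -/
def multiDeriv {d : ℕ} (I : Fin d → ℕ) (f : (Fin d → ℂ) → ℂ) : (Fin d → ℂ) → ℂ :=
  (List.finRange d).foldr (fun i g => (partialDeriv i)^[I i] g) f

/-- `(D^I F)(1, …, 1)` for the generating function `F` of `u`. -/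
def derivAtOne {d : ℕ} (u : (Fin d → ℤ) → ℝ) (I : Fin d → ℕ) : ℂ :=
  multiDeriv I (genFun u) 1

/-- `I₀` is a first non-vanishing derivative of the generating function at `(1, …, 1)`. (For
multi-indices, `J < I₀` means `J ≤ I₀` componentwise and `J ≠ I₀`.) -/
def IsLeadingIndex {d : ℕ} (u : (Fin d → ℤ) → ℝ) (I₀ : Fin d → ℕ) : Prop :=
  derivAtOne u I₀ ≠ 0 ∧ ∀ J, J < I₀ → derivAtOne u J = 0

/-- The radius `R_l`, with `c_u = (D^{I₀} F)(1, …, 1)`. -/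
def radius {d : ℕ} (u : (Fin d → ℤ) → ℝ) (C α : ℝ) (I₀ : Fin d → ℕ) (l : ℝ) : ℝ :=
  max (2 * l + 2 / α *
      Real.log (2 * 3 ^ d * C / (‖derivAtOne u I₀‖ * (1 - Real.exp (-α / 2)))))
    (8 * ((d : ℝ) + (∑ i, I₀ i : ℕ)) ^ 2 / α ^ 2)

/-- `ρ ∈ BV(ℝ)`: `ρ` is integrable and its distributional derivative is a finite signed measure. -/
def IsBV (ρ : ℝ → ℝ) : Prop :=
  Integrable ρ ∧ ∃ ν : SignedMeasure ℝ, ∀ φ : ℝ → ℝ,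
    ContDiff ℝ ((⊤ : ℕ∞) : WithTop ℕ∞) φ → HasCompactSupport φ →
    (∫ x, φ x ∂ν.toJordanDecomposition.posPart) - (∫ x, φ x ∂ν.toJordanDecomposition.negPart) =
      -∫ x, ρ x * deriv φ x

/-- `‖ρ‖_Var = sup {∫ ρ v' : v ∈ C_c^∞(ℝ), |v| ≤ 1}`. -/
def varNorm (ρ : ℝ → ℝ) : ℝ :=
  sSup {t | ∃ v : ℝ → ℝ, ContDiff ℝ ((⊤ : ℕ∞) : WithTop ℕ∞) v ∧ HasCompactSupport v ∧
    (∀ x, |v x| ≤ 1) ∧ t = ∫ x, ρ x * deriv v x}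

/-- `μ` has the density `ρ` with respect to Lebesgue measure. -/
def HasDensity (μ : Measure ℝ) (ρ : ℝ → ℝ) : Prop :=
  0 ≤ᵐ[volume] ρ ∧ μ = volume.withDensity fun x => ENNReal.ofReal (ρ x)

end AlloyWegner

end

open AlloyWegner

/-! Since `u` may change sign, the eigenvalues need not be monotone in any single coupling. The
remedy is a direction in coupling space along which they all increase. The derivatives of the
generating function at `1` are the sums of `u(-k)` against products of falling factorials of `k`.
Expanding the monomial `(x+k)^{I₀}` in falling factorials of `k`, only the leading term survives
when `I₀` is a leading index, so `∑ₖ k^{I₀} u(x-k) = c_u` for every `x` (`IsLeadingIndex.hasSum`).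
The radius `R_l` is large enough that dropping all `k` outside `Γ` costs at most `|c_u|/2` for `x ∈
Λ_l` (`sum_abs_le_of_disjoint_box`). Hence moving the couplings in `Γ` along `a = ± k^{I₀}` raises
the potential on `Λ_l` by at least `|c_u|/2` per unit.

By min-max, a shift by `t a` with `t = 2|I|/|c_u|` pushes every eigenvalue up by at least `|I|`. Up
to endpoints, the number of eigenvalues in `I` is therefore at most `G(η) - G(η + t a)`, where `G`
counts eigenvalues below the right end of `I` (`spectralCount_glue_add_le`). Integrating against a
BV density, a shift by `s` of one coordinate changes the mean of a function with values in `[0, M]`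
by at most `M |s| ‖ρ‖_Var`; coordinates are shifted one after the other
(`lintegral_pi_le_lintegral_shift`). With `M = |Λ_l|` and `∑ |aₖ| = O((2l+1)^{d+N})` this is the
estimate.

A leading index exists because otherwise all moments of `u` vanish, and an exponentially decaying
`u` is determined by its moments (`ext_of_moments_eq`). The constant does not depend on `C` and `α`,
because the weights are cut off at a box belonging to one fixed pair of decay constants, and it can
be chosen for all leading indices at once, because they form an antichain in `ℕ^d`, hence a finite
set. -/

noncomputable section

namespace AlloyWegner

/-! ### Eigenvalue counting functions and the min-max principle -/

section SpectralCount

variable {E : Type*} [NormedAddCommGroup E] [InnerProductSpace ℂ E] [FiniteDimensional ℂ E]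
  {n : ℕ} {T : E →ₗ[ℂ] E}

/-- The number of eigenvalues of `T` in `B`, counted with multiplicity. -/
def spectralCount (T : E →ₗ[ℂ] E) (B : Set ℝ) : ℕ :=
  Module.finrank ℂ (⨆ e ∈ B, Module.End.eigenspace T (e : ℂ) : Submodule ℂ E)

theorem trace_spectralProjection (T : E →ₗ[ℂ] E) (B : Set ℝ) :
    LinearMap.trace ℂ _ (spectralProjection T B) = spectralCount T B := by
  refine LinearMap.IsProj.trace (p := ⨆ e ∈ B, Module.End.eigenspace T (e : ℂ)) ⟨?_, ?_⟩
  · intro x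
    exact Submodule.starProjection_apply_mem _ x
  · intro x hx
    exact Submodule.starProjection_eq_self_iff.2 hx

theorem iSup_eigenspace_eq_span (hT : T.IsSymmetric) (hn : Module.finrank ℂ E = n) (B : Set ℝ) :
    (⨆ e ∈ B, Module.End.eigenspace T (e : ℂ)) =
      Submodule.span ℂ (hT.eigenvectorBasis hn '' {i | hT.eigenvalues hn i ∈ B}) := by
  apply le_antisymm
  · refine iSup₂_le fun e he ψ hψ => ?_
    rw [Module.End.mem_eigenspace_iff] at hψ
    rw [← (hT.eigenvectorBasis hn).sum_repr ψ]
    refine Submodule.sum_mem _ fun i _ => ?_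
    by_cases hi : (hT.eigenvectorBasis hn).repr ψ i = 0
    · simp [hi]
    · refine Submodule.smul_mem _ _ (Submodule.subset_span ⟨i, ?_, rfl⟩)
      have h := hT.eigenvectorBasis_apply_self_apply hn ψ i
      rw [hψ, map_smul, PiLp.smul_apply, smul_eq_mul] at h
      have h' := mul_right_cancel₀ hi h
      have : hT.eigenvalues hn i = e := Complex.ofReal_injective h'.symm
      simpa [this] using he
  · rw [Submodule.span_le]
    rintro _ ⟨i, hi, rfl⟩
    have hi' : hT.eigenvalues hn i ∈ B := hi
    refine Submodule.mem_iSup_of_mem _ (Submodule.mem_iSup_of_mem hi' ?_)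
    exact (hT.hasEigenvector_eigenvectorBasis hn i).1

open Classical in
theorem finrank_span_eigenvectorBasis (hT : T.IsSymmetric) (hn : Module.finrank ℂ E = n)
    (S : Set (Fin n)) :
    Module.finrank ℂ (Submodule.span ℂ (hT.eigenvectorBasis hn '' S)) =
      (Finset.univ.filter fun i => i ∈ S).card := by
  have hli : LinearIndependent ℂ (fun i : S => hT.eigenvectorBasis hn i) :=
    (hT.eigenvectorBasis hn).orthonormal.linearIndependent.comp _ Subtype.val_injective
  have := finrank_span_eq_card hli
  rw [Set.range_comp' , Subtype.range_coe] at this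
  rw [this, Fintype.card_subtype]

open Classical in
theorem spectralCount_eq_card (hT : T.IsSymmetric) (hn : Module.finrank ℂ E = n) (B : Set ℝ) :
    spectralCount T B = (Finset.univ.filter fun i => hT.eigenvalues hn i ∈ B).card := by
  rw [spectralCount, iSup_eigenspace_eq_span hT hn, finrank_span_eigenvectorBasis]
  rfl

/-- The quadratic form in the eigenbasis. -/
theorem re_inner_eq_sum (hT : T.IsSymmetric) (hn : Module.finrank ℂ E = n) (ψ : E) :
    (inner ℂ ψ (T ψ)).re =
      ∑ i, hT.eigenvalues hn i * ‖(hT.eigenvectorBasis hn).repr ψ i‖ ^ 2 := by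
  rw [← (hT.eigenvectorBasis hn).sum_inner_mul_inner, Complex.re_sum]
  refine Finset.sum_congr rfl fun i _ => ?_
  have h := hT.eigenvectorBasis_apply_self_apply hn ψ i
  rw [OrthonormalBasis.repr_apply_apply, OrthonormalBasis.repr_apply_apply] at h
  rw [h, OrthonormalBasis.repr_apply_apply, ← inner_conj_symm]
  rw [mul_left_comm, RCLike.conj_mul]
  norm_cast

theorem norm_sq_eq_sum (hT : T.IsSymmetric) (hn : Module.finrank ℂ E = n) (ψ : E) :
    ‖ψ‖ ^ 2 = ∑ i, ‖(hT.eigenvectorBasis hn).repr ψ i‖ ^ 2 := by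
  rw [← (hT.eigenvectorBasis hn).repr.norm_map ψ, EuclideanSpace.norm_sq_eq]

theorem repr_eq_zero_of_mem_span (hT : T.IsSymmetric) (hn : Module.finrank ℂ E = n)
    {S : Set (Fin n)} {ψ : E} (hψ : ψ ∈ Submodule.span ℂ (hT.eigenvectorBasis hn '' S))
    {i : Fin n} (hi : i ∉ S) : (hT.eigenvectorBasis hn).repr ψ i = 0 := by
  induction hψ using Submodule.span_induction with
  | mem x hx =>
    obtain ⟨j, hj, rfl⟩ := hx
    have : i ≠ j := fun h => hi (h ▸ hj)
    simp [this]
  | zero => simp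
  | add x y _ _ hx hy => simp [hx, hy]
  | smul c x _ hx => simp [hx]

/-- One half of the min-max principle: a subspace on which the quadratic form is below `b` has at
most as many dimensions as `T` has eigenvalues below `b`. -/
theorem finrank_le_spectralCount_Iio (hT : T.IsSymmetric) {b : ℝ} {W : Submodule ℂ E}
    (hW : ∀ ψ ∈ W, ψ ≠ 0 → (inner ℂ ψ (T ψ)).re < b * ‖ψ‖ ^ 2) :
    Module.finrank ℂ W ≤ spectralCount T (Set.Iio b) := by
  classical
  obtain ⟨n, hn⟩ : ∃ n, Module.finrank ℂ E = n := ⟨_, rfl⟩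
  -- On `V` the form is at least `b ‖ψ‖²`, so `W` meets `V` only in zero, and the codimension of `V`
  -- is the number of eigenvalues below `b`.
  set V := Submodule.span ℂ (hT.eigenvectorBasis hn '' {i | b ≤ hT.eigenvalues hn i}) with hV
  have hdisj : Disjoint W V := by
    rw [Submodule.disjoint_def]
    intro ψ hψW hψV
    by_contra hne
    have h1 := hW ψ hψW hne
    rw [re_inner_eq_sum hT hn, norm_sq_eq_sum hT hn, Finset.mul_sum] at h1
    refine absurd h1 (not_lt.2 (Finset.sum_le_sum fun i _ => ?_))
    by_cases hi : b ≤ hT.eigenvalues hn i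
    · gcongr
    · rw [repr_eq_zero_of_mem_span hT hn hψV hi]
      simp
  have h1 := Submodule.finrank_add_finrank_le_of_disjoint hdisj
  rw [hV, finrank_span_eigenvectorBasis, hn] at h1
  rw [spectralCount_eq_card hT hn]
  have h2 := Finset.card_filter_add_card_filter_not (s := (Finset.univ : Finset (Fin n)))
    (fun i => hT.eigenvalues hn i ∈ Set.Iio b)
  simp only [Set.mem_Iio, not_lt, Finset.card_univ, Fintype.card_fin] at h2
  simp only [Set.mem_ofPred_eq] at h1
  simp only [Set.mem_Iio]
  omega

/-- On the spectral subspace below `b` the quadratic form is uniformly below `b`. -/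
theorem exists_form_le_of_mem_spectralSubspace (hT : T.IsSymmetric) (b : ℝ) :
    ∃ ε > 0, ∀ ψ ∈ (⨆ e ∈ Set.Iio b, Module.End.eigenspace T ((e : ℝ) : ℂ) : Submodule ℂ E),
      (inner ℂ ψ (T ψ)).re ≤ (b - ε) * ‖ψ‖ ^ 2 := by
  obtain ⟨n, hn⟩ : ∃ n, Module.finrank ℂ E = n := ⟨_, rfl⟩
  -- There are finitely many eigenvalues, so those below `b` stay away from `b` by a common gap.
  have hε : ∃ ε > 0, ∀ i, hT.eigenvalues hn i < b → hT.eigenvalues hn i ≤ b - ε := by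
    have : ∀ᶠ ε in nhdsWithin (0 : ℝ) (Set.Ioi 0),
        ∀ i, hT.eigenvalues hn i < b → hT.eigenvalues hn i ≤ b - ε := by
      rw [Filter.eventually_all]
      intro i
      by_cases hi : hT.eigenvalues hn i < b
      · filter_upwards [Ioo_mem_nhdsGT (sub_pos.2 hi)] with ε hε _
        linarith [hε.2]
      · simp [hi]
    obtain ⟨ε, h1, h2⟩ := (this.and self_mem_nhdsWithin).exists
    exact ⟨ε, h2, h1⟩
  obtain ⟨ε, hε0, hε⟩ := hε
  refine ⟨ε, hε0, fun ψ hψ => ?_⟩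
  rw [iSup_eigenspace_eq_span hT hn] at hψ
  rw [re_inner_eq_sum hT hn, norm_sq_eq_sum hT hn, Finset.mul_sum]
  refine Finset.sum_le_sum fun i _ => ?_
  by_cases hi : hT.eigenvalues hn i < b
  · gcongr
    exact hε i hi
  · rw [repr_eq_zero_of_mem_span hT hn hψ hi]
    simp

/-- Monotonicity of the eigenvalue counting function in the operator. -/
theorem spectralCount_Iio_le_of_form_le {T' : E →ₗ[ℂ] E} (hT : T.IsSymmetric)
    (hT' : T'.IsSymmetric) {a b : ℝ}
    (h : ∀ ψ, (inner ℂ ψ (T ψ)).re + (b - a) * ‖ψ‖ ^ 2 ≤ (inner ℂ ψ (T' ψ)).re) :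
    spectralCount T' (Set.Iio b) ≤ spectralCount T (Set.Iio a) := by
  obtain ⟨ε, hε, hform⟩ := exists_form_le_of_mem_spectralSubspace hT' b
  refine finrank_le_spectralCount_Iio hT fun ψ hψ hne => ?_
  have h1 := hform ψ hψ
  have h2 := h ψ
  have h3 : 0 < ‖ψ‖ ^ 2 := by positivity
  nlinarith

theorem spectralCount_le (T : E →ₗ[ℂ] E) (B : Set ℝ) : spectralCount T B ≤ Module.finrank ℂ E :=
  Submodule.finrank_le _

theorem spectralCount_add_le (hT : T.IsSymmetric) {a b : ℝ} (hab : a ≤ b) {B : Set ℝ}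
    (hB : B ⊆ Set.Ico a b) :
    spectralCount T B + spectralCount T (Set.Iio a) ≤ spectralCount T (Set.Iio b) := by
  classical
  obtain ⟨n, hn⟩ : ∃ n, Module.finrank ℂ E = n := ⟨_, rfl⟩
  simp only [spectralCount_eq_card hT hn]
  rw [← Finset.card_union_of_disjoint]
  · refine Finset.card_le_card fun i hi => ?_
    simp only [Finset.mem_union, Finset.mem_filter, Finset.mem_univ, true_and, Set.mem_Iio] at hi ⊢
    rcases hi with hi | hi
    · exact (hB hi).2
    · exact hi.trans_le hab
  · rw [Finset.disjoint_filter]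
    intro i _ hi h
    exact absurd (hB hi).1 (not_le.2 h)

/-- If a family of symmetric operators depends continuously on a parameter, in the sense of
quadratic forms, then its eigenvalue counting functions are measurable. -/
theorem measurable_spectralCount {X : Type*} [TopologicalSpace X] [MeasurableSpace X]
    [BorelSpace X] {S : X → E →ₗ[ℂ] E} (hS : ∀ x, (S x).IsSymmetric)
    (hcont : ∀ x, ∀ ε > 0, ∀ᶠ y in nhds x, ∀ ψ,
      (inner ℂ ψ (S y ψ)).re ≤ (inner ℂ ψ (S x ψ)).re + ε * ‖ψ‖ ^ 2)
    {B : Set ℝ} (hB : MeasurableSet B) : Measurable fun x => spectralCount (S x) B := by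
  classical
  obtain ⟨n, hn⟩ : ∃ n, Module.finrank ℂ E = n := ⟨_, rfl⟩
  -- The spectral subspace at `x` still has form below `b` at nearby parameters, because the gap `ε`
  -- absorbs the perturbation. So the count below `b` is lower semicontinuous.
  have hIio : ∀ b, Measurable fun x => spectralCount (S x) (Set.Iio b) := by
    intro b
    refine LowerSemicontinuous.measurable fun x m hm => ?_
    obtain ⟨ε, hε, hform⟩ := exists_form_le_of_mem_spectralSubspace (hS x) b
    filter_upwards [hcont x (ε / 2) (by positivity)] with y hy
    refine hm.trans_le (finrank_le_spectralCount_Iio (hS y) fun ψ hψ hne => ?_)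
    have h1 := hform ψ hψ
    have h2 := hy ψ
    have h3 : 0 < ‖ψ‖ ^ 2 := by positivity
    nlinarith
  -- As a measure in `B`, the count is determined by the half-lines, which form a generating
  -- π-system; this passes measurability on to all Borel sets.
  let ν : X → Measure ℝ := fun x => ∑ i, Measure.dirac ((hS x).eigenvalues hn i)
  have hν : ∀ x (A : Set ℝ), MeasurableSet A → ν x A = (spectralCount (S x) A : ENNReal) := by
    intro x A hA
    simp only [ν, Measure.coe_finsetSum, Finset.sum_apply, Measure.dirac_apply' _ hA,
      spectralCount_eq_card (hS x) hn]
    simp [Set.indicator_apply]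
  have hfin : ∀ x, IsFiniteMeasure (ν x) := by
    intro x
    exact ⟨by rw [hν x _ MeasurableSet.univ]; exact ENNReal.natCast_lt_top _⟩
  have hmeas : Measurable ν := by
    refine Measurable.measure_of_isPiSystem (borel_eq_generateFrom_Iio ℝ ▸ BorelSpace.measurable_eq)
      isPiSystem_Iio ?_ ?_
    · rintro _ ⟨b, rfl⟩
      simp only [hν _ _ measurableSet_Iio]
      exact measurable_from_top.comp (hIio b)
    · simp only [hν _ _ MeasurableSet.univ, spectralCount_eq_card (hS _) hn, Set.mem_univ]
      exact measurable_const
  have h := Measure.measurable_measure.1 hmeas B hB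
  simp only [hν _ _ hB] at h
  have h' := h.ennreal_toReal
  simp only [ENNReal.toReal_natCast] at h'
  have h2 := Nat.measurable_floor.comp h'
  simpa [Function.comp_def] using h2

end SpectralCount

/-! ### Shifting the argument under a BV density -/

section BoundedVariation

variable {ρ : ℝ → ℝ}

theorem bddAbove_varNorm (hρ : IsBV ρ) :
    BddAbove {t | ∃ v : ℝ → ℝ, ContDiff ℝ ((⊤ : ℕ∞) : WithTop ℕ∞) v ∧ HasCompactSupport v ∧
      (∀ x, |v x| ≤ 1) ∧ t = ∫ x, ρ x * deriv v x} := by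
  obtain ⟨-, ν, hν⟩ := hρ
  refine ⟨ν.toJordanDecomposition.posPart.real Set.univ +
    ν.toJordanDecomposition.negPart.real Set.univ, ?_⟩
  rintro _ ⟨v, hv, hvc, hv1, rfl⟩
  have h := hν v hv hvc
  have h1 : ‖∫ x, v x ∂ν.toJordanDecomposition.posPart‖ ≤
      1 * ν.toJordanDecomposition.posPart.real Set.univ :=
    norm_integral_le_of_norm_le_const (Filter.Eventually.of_forall hv1)
  have h2 : ‖∫ x, v x ∂ν.toJordanDecomposition.negPart‖ ≤
      1 * ν.toJordanDecomposition.negPart.real Set.univ :=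
    norm_integral_le_of_norm_le_const (Filter.Eventually.of_forall hv1)
  rw [Real.norm_eq_abs, abs_le] at h1 h2
  linarith [h1.1, h2.2]

theorem varNorm_nonneg (hρ : IsBV ρ) : 0 ≤ varNorm ρ :=
  le_csSup (bddAbove_varNorm hρ) ⟨0, contDiff_const, HasCompactSupport.zero, by simp, by simp⟩

theorem integral_mul_deriv_le (hρ : IsBV ρ) {v : ℝ → ℝ} {K : ℝ}
    (hv : ContDiff ℝ ((⊤ : ℕ∞) : WithTop ℕ∞) v) (hvc : HasCompactSupport v)
    (hK : ∀ x, |v x| ≤ K) : ∫ x, ρ x * deriv v x ≤ K * varNorm ρ := by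
  have hK0 : 0 ≤ K := (abs_nonneg _).trans (hK 0)
  rcases hK0.eq_or_lt with rfl | hpos
  · have : v = 0 := by
      funext x
      exact abs_nonpos_iff.1 (hK x)
    simp [this]
  · have h : ∫ x, ρ x * deriv (fun y => K⁻¹ * v y) x ≤ varNorm ρ := by
      refine le_csSup (bddAbove_varNorm hρ)
        ⟨fun y => K⁻¹ * v y, contDiff_const.mul hv, hvc.mul_left, fun x => ?_, rfl⟩
      rw [abs_mul, abs_of_pos (inv_pos.2 hpos), inv_mul_le_iff₀ hpos, mul_one]
      exact hK x
    have h' : ∀ x, ρ x * deriv (fun y => K⁻¹ * v y) x = K⁻¹ * (ρ x * deriv v x) := by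
      intro x
      rw [deriv_const_mul _ (hv.differentiable (by simp) x)]
      ring
    simp only [h', integral_const_mul] at h
    rwa [inv_mul_le_iff₀ hpos] at h

/-- A primitive `G` of `g` need not have compact support, but `G(x) - G(x + s)` does: it is the
integral of `g` over an interval of length `|s|`, which also gives the bound. It is the test
function that turns a shift into a pairing with `ρ'`. -/
theorem exists_primitive_difference {g : ℝ → ℝ} (hg : ContDiff ℝ ((⊤ : ℕ∞) : WithTop ℕ∞) g)
    (hgc : HasCompactSupport g) {M : ℝ} (hM : ∀ x, |g x| ≤ M) (s : ℝ) :
    ∃ v : ℝ → ℝ, ContDiff ℝ ((⊤ : ℕ∞) : WithTop ℕ∞) v ∧ HasCompactSupport v ∧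
      (∀ x, |v x| ≤ M * |s|) ∧ ∀ x, deriv v x = g x - g (x + s) := by
  have hint : ∀ a b, IntervalIntegrable g volume a b := hg.continuous.intervalIntegrable
  have hG : ∀ x, HasDerivAt (fun y => ∫ t in (0 : ℝ)..y, g t) (g x) x := fun x =>
    intervalIntegral.integral_hasDerivAt_right (hint 0 x)
      hg.continuous.aestronglyMeasurable.stronglyMeasurableAtFilter hg.continuous.continuousAt
  let v : ℝ → ℝ := fun x => (∫ t in (0 : ℝ)..x, g t) - ∫ t in (0 : ℝ)..(x + s), g t
  have hv : ∀ x, HasDerivAt v (g x - g (x + s)) x := fun x =>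
    (hG x).sub ((hG (x + s)).comp_add_const x s)
  have hv' : ∀ x, v x = ∫ t in (x + s)..x, g t := fun x =>
    intervalIntegral.integral_interval_sub_left (hint _ _) (hint _ _)
  have hderiv : deriv v = fun x => g x - g (x + s) := funext fun x => (hv x).deriv
  refine ⟨v, ?_, ?_, fun x => ?_, fun x => (hv x).deriv⟩
  · rw [contDiff_infty_iff_deriv]
    refine ⟨fun x => (hv x).differentiableAt, ?_⟩
    rw [hderiv]
    exact hg.sub (hg.comp (contDiff_id.add contDiff_const))
  · obtain ⟨R, hR⟩ := hgc.isBounded.subset_closedBall 0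
    refine HasCompactSupport.of_support_subset_isCompact
      (isCompact_closedBall (0 : ℝ) (R + |s|)) fun x hx => ?_
    by_contra hxR
    refine hx ?_
    rw [hv']
    refine intervalIntegral.integral_zero_ae (Filter.Eventually.of_forall fun t ht => ?_)
    by_contra hgt
    have h1 := hR (subset_tsupport g hgt)
    simp only [Metric.mem_closedBall, dist_zero_right, Real.norm_eq_abs, not_le] at h1 hxR
    have h2 : |x - t| ≤ |s| := by
      have := Set.uIoc_subset_uIcc ht
      have h3 := Set.abs_sub_right_of_mem_uIcc this
      rw [show x - (x + s) = -s by ring, abs_neg] at h3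
      exact h3
    have h3 : |x| ≤ |x - t| + |t| := by simpa using abs_add_le (x - t) t
    linarith
  · rw [hv']
    have := intervalIntegral.norm_integral_le_of_norm_le_const (a := x + s) (b := x) (f := g)
      (C := M) fun t _ => hM t
    rwa [Real.norm_eq_abs, show x - (x + s) = -s by ring, abs_neg] at this

theorem integral_eq_of_hasDensity {μ : Measure ℝ} (hμ : HasDensity μ ρ) (hρ : IsBV ρ)
    (g : ℝ → ℝ) : ∫ x, g x ∂μ = ∫ x, ρ x * g x := by
  obtain ⟨hpos, rfl⟩ := hμ
  rw [integral_withDensity_eq_integral_toReal_smul₀ hρ.1.aemeasurable.ennreal_ofReal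
    (Filter.Eventually.of_forall fun _ => ENNReal.ofReal_lt_top)]
  refine integral_congr_ae ?_
  filter_upwards [hpos] with x hx
  rw [ENNReal.toReal_ofReal hx, smul_eq_mul]

variable {μ : Measure ℝ} [IsProbabilityMeasure μ]

theorem integral_sub_integral_shift_le_of_contDiff (hμ : HasDensity μ ρ) (hρ : IsBV ρ)
    {g : ℝ → ℝ} (hg : ContDiff ℝ ((⊤ : ℕ∞) : WithTop ℕ∞) g) (hgc : HasCompactSupport g)
    {M : ℝ} (hM : ∀ x, |g x| ≤ M) (s : ℝ) :
    ∫ x, g x ∂μ - ∫ x, g (x + s) ∂μ ≤ M * |s| * varNorm ρ := by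
  obtain ⟨v, hv, hvc, hvM, hvd⟩ := exists_primitive_difference hg hgc hM s
  have h := integral_mul_deriv_le hρ hv hvc hvM
  simp only [hvd] at h
  rw [← integral_eq_of_hasDensity hμ hρ, integral_sub] at h
  · exact h
  · exact Integrable.of_bound hg.continuous.aestronglyMeasurable M (Filter.Eventually.of_forall hM)
  · exact Integrable.of_bound (by fun_prop) M (Filter.Eventually.of_forall fun x => hM (x + s))

/-- Extends the smooth case by approximation in `L¹`. Working with the sum of `μ` and its translate
controls the errors of both integrals at once. -/
theorem integral_sub_integral_shift_le (hμ : HasDensity μ ρ) (hρ : IsBV ρ)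
    {g : ℝ → ℝ} (hg : Measurable g) {M : ℝ} (hM : ∀ x, |g x| ≤ M) (s : ℝ) :
    ∫ x, g x ∂μ - ∫ x, g (x + s) ∂μ ≤ M * |s| * varNorm ρ := by
  have hM0 : 0 ≤ M := (abs_nonneg _).trans (hM 0)
  have hshift : Measurable fun x : ℝ => x + s := by fun_prop
  have hV := varNorm_nonneg hρ
  -- The smooth approximant is bounded only by `M + ε`, which accounts for `|s| * varNorm ρ`; the
  -- `3` is the `L¹` error, namely `ε` from the continuous approximation and `ε` times the total
  -- mass `2` from smoothing.
  suffices h : ∀ ε > 0, ∫ x, g x ∂μ - ∫ x, g (x + s) ∂μ ≤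
      M * |s| * varNorm ρ + (|s| * varNorm ρ + 3) * ε by
    refine le_of_forall_pos_le_add fun δ hδ => ?_
    have h1 := h (δ / (|s| * varNorm ρ + 3)) (by positivity)
    rwa [mul_div_cancel₀ _ (by positivity)] at h1
  intro ε hε
  let m : Measure ℝ := μ + μ.map fun x => x + s
  have : IsProbabilityMeasure (μ.map fun x => x + s) :=
    Measure.isProbabilityMeasure_map hshift.aemeasurable
  have hgm : Integrable g m := Integrable.of_bound hg.aestronglyMeasurable M
    (Filter.Eventually.of_forall hM)
  obtain ⟨k, hkc, hk, hkcont, -⟩ := hgm.exists_hasCompactSupport_integral_sub_le hε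
  -- Clamping to `[-M, M]` restores the sup bound without increasing the distance to `g`.
  let k' : ℝ → ℝ := fun x => max (-M) (min M (k x))
  have hk'cont : Continuous k' := by fun_prop
  have hk'c : HasCompactSupport k' :=
    hkc.comp_left (g := fun y => max (-M) (min M y)) (by simp [hM0])
  have hk'M : ∀ x, |k' x| ≤ M := fun x =>
    abs_le.2 ⟨le_max_left _ _, max_le (by linarith) (min_le_left _ _)⟩
  have hk'g : ∀ x, |g x - k' x| ≤ |g x - k x| := by
    intro x
    have h1 := abs_le.1 (hM x)
    simp only [k']
    grind
  obtain ⟨f, hf, hfd, hfs⟩ := hk'cont.exists_contDiff_approx ⊤ (ε := fun _ => ε) continuous_const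
    fun _ => hε
  have hfc : HasCompactSupport f := hk'c.mono hfs
  have hfk : ∀ x, |f x - k' x| ≤ ε := fun x => (hfd x).le
  have hfM : ∀ x, |f x| ≤ M + ε := by
    intro x
    have h1 := abs_le.1 (hfk x)
    have h2 := abs_le.1 (hk'M x)
    exact abs_le.2 ⟨by linarith, by linarith⟩
  have hmain := integral_sub_integral_shift_le_of_contDiff hμ hρ hf hfc hfM s
  have hfint : Integrable f m := Integrable.of_bound hf.continuous.aestronglyMeasurable (M + ε)
    (Filter.Eventually.of_forall hfM)
  have hkint : Integrable k m := hkcont.integrable_of_hasCompactSupport hkc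
  have hdiff : ∫ x, |g x - f x| ∂m ≤ 3 * ε := by
    calc ∫ x, |g x - f x| ∂m ≤ ∫ x, (‖g x - k x‖ + ε) ∂m := by
          refine integral_mono (hgm.sub hfint).abs ((hgm.sub hkint).norm.add (integrable_const ε))
            fun x => ?_
          have h1 := hk'g x
          have h2 := hfk x
          have h3 := abs_sub_le (g x) (k' x) (f x)
          rw [abs_sub_comm (k' x)] at h3
          simp only [Real.norm_eq_abs]
          linarith
      _ = ∫ x, ‖g x - k x‖ ∂m + ε * 2 := by
          have hadd := integral_add (hgm.sub hkint).norm (integrable_const (μ := m) ε)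
          simp only [Pi.sub_apply] at hadd
          rw [hadd, integral_const]
          have : m.real Set.univ = 2 := by
            simp only [m, measureReal_def, Measure.add_apply, measure_univ]
            norm_num
          rw [this, smul_eq_mul, mul_comm]
      _ ≤ 3 * ε := by linarith
  have hm : ∀ φ : ℝ → ℝ, Integrable φ m →
      Integrable φ μ ∧ Integrable (fun x => φ (x + s)) μ ∧
      ∫ x, φ x ∂m = ∫ x, φ x ∂μ + ∫ x, φ (x + s) ∂μ := by
    intro φ hφ
    have h1 := integrable_add_measure.1 hφ
    have h2 : Integrable (φ ∘ fun x => x + s) μ :=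
      (integrable_map_measure h1.2.aestronglyMeasurable hshift.aemeasurable).1 h1.2
    refine ⟨h1.1, h2, ?_⟩
    rw [integral_add_measure h1.1 h1.2, integral_map hshift.aemeasurable h1.2.aestronglyMeasurable]
  obtain ⟨hd1, hd2, hd3⟩ := hm _ (hgm.sub hfint).abs
  obtain ⟨hg1, hg2, -⟩ := hm _ hgm
  obtain ⟨hf1, hf2, -⟩ := hm _ hfint
  have e1 : ∫ x, g x ∂μ - ∫ x, f x ∂μ ≤ ∫ x, |g x - f x| ∂μ := by
    rw [← integral_sub hg1 hf1]
    exact integral_mono (hg1.sub hf1) hd1 fun x => le_abs_self _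
  have e2 : ∫ x, f (x + s) ∂μ - ∫ x, g (x + s) ∂μ ≤ ∫ x, |g (x + s) - f (x + s)| ∂μ := by
    rw [← integral_sub hf2 hg2]
    refine integral_mono (hf2.sub hg2) hd2 fun x => ?_
    rw [abs_sub_comm]
    exact le_abs_self _
  simp only [Pi.sub_apply] at hd3
  rw [hd3] at hdiff
  nlinarith

/-- Shifting a bounded function changes its expectation by at most a multiple of the shift. -/
theorem lintegral_le_lintegral_shift (hμ : HasDensity μ ρ) (hρ : IsBV ρ)
    {g : ℝ → ℝ} (hg : Measurable g) {M : ℝ} (h0 : ∀ x, 0 ≤ g x) (hM : ∀ x, g x ≤ M) (s : ℝ) :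
    ∫⁻ x, ENNReal.ofReal (g x) ∂μ ≤
      ∫⁻ x, ENNReal.ofReal (g (x + s)) ∂μ + ENNReal.ofReal (M * |s| * varNorm ρ) := by
  have habs : ∀ x, |g x| ≤ M := fun x => by rw [abs_of_nonneg (h0 x)]; exact hM x
  have h := integral_sub_integral_shift_le hμ hρ hg habs s
  have hM0 : 0 ≤ M := (h0 0).trans (hM 0)
  have hV := varNorm_nonneg hρ
  rw [← ofReal_integral_eq_lintegral_ofReal
      (Integrable.of_bound hg.aestronglyMeasurable M (Filter.Eventually.of_forall habs))
      (Filter.Eventually.of_forall h0),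
    ← ofReal_integral_eq_lintegral_ofReal (f := fun x => g (x + s))
      (Integrable.of_bound (hg.comp (measurable_add_const s)).aestronglyMeasurable M
        (Filter.Eventually.of_forall fun x => habs (x + s)))
      (Filter.Eventually.of_forall fun x => h0 (x + s)),
    ← ENNReal.ofReal_add (integral_nonneg fun x => h0 (x + s)) (by positivity)]
  exact ENNReal.ofReal_le_ofReal (by linarith)

variable {ι : Type*} [Fintype ι]

/-- The product version of `lintegral_le_lintegral_shift`, one coordinate after the other. -/
theorem lintegral_pi_le_lintegral_shift (hμ : HasDensity μ ρ) (hρ : IsBV ρ)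
    {g : (ι → ℝ) → ℝ} (hg : Measurable g) {M : ℝ} (h0 : ∀ x, 0 ≤ g x) (hM : ∀ x, g x ≤ M)
    (s : ι → ℝ) :
    ∫⁻ x, ENNReal.ofReal (g x) ∂(Measure.pi fun _ : ι => μ) ≤
      ∫⁻ x, ENNReal.ofReal (g (x + s)) ∂(Measure.pi fun _ : ι => μ) +
        ENNReal.ofReal (M * (∑ i, |s i|) * varNorm ρ) := by
  classical
  have hM0 : 0 ≤ M := (h0 0).trans (hM 0)
  have hV := varNorm_nonneg hρ
  suffices h : ∀ S : Finset ι,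
      ∫⁻ x, ENNReal.ofReal (g x) ∂(Measure.pi fun _ : ι => μ) ≤
      ∫⁻ x, ENNReal.ofReal (g (x + fun i => if i ∈ S then s i else 0))
          ∂(Measure.pi fun _ : ι => μ) +
        ENNReal.ofReal (M * (∑ i ∈ S, |s i|) * varNorm ρ) by
    simpa using h Finset.univ
  intro S
  induction S using Finset.induction_on with
  | empty =>
    simp only [Finset.notMem_empty, if_false, Finset.sum_empty, mul_zero, zero_mul,
      ENNReal.ofReal_zero, add_zero]
    exact le_of_eq (lintegral_congr fun x => by congr 2; funext i; simp)
  | insert j S hj ih =>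
    refine ih.trans ?_
    have hstep : ∫⁻ x, ENNReal.ofReal (g (x + fun i => if i ∈ S then s i else 0))
          ∂(Measure.pi fun _ : ι => μ) ≤
        ∫⁻ x, (ENNReal.ofReal (g (x + fun i => if i ∈ insert j S then s i else 0)) +
          ENNReal.ofReal (M * |s j| * varNorm ρ)) ∂(Measure.pi fun _ : ι => μ) := by
      -- With the other coordinates frozen this is the one-dimensional inequality, whose error term
      -- does not depend on them.
      refine lintegral_le_of_lmarginal_le {j} (by fun_prop) (by fun_prop) ?_
      rw [lmarginal_singleton, lmarginal_singleton]
      intro x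
      have hupd : Measurable fun t : ℝ => Function.update x j t := measurable_update x
      have h := lintegral_le_lintegral_shift hμ hρ
        (g := fun t => g (Function.update x j t + fun i => if i ∈ S then s i else 0))
        (hg.comp (hupd.add_const _)) (M := M)
        (fun t => h0 _) (fun t => hM _) (s j)
      beta_reduce
      rw [lintegral_add_right _ measurable_const, lintegral_const, measure_univ, mul_one]
      refine h.trans (add_le_add (le_of_eq (lintegral_congr fun t => ?_)) le_rfl)
      congr 2
      funext i
      by_cases hi : i = j
      · subst hi
        simp [hj]
      · simp [hi]
    rw [lintegral_add_right _ measurable_const, lintegral_const, measure_univ, mul_one] at hstep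
    refine (add_le_add hstep le_rfl).trans ?_
    rw [add_assoc, ← ENNReal.ofReal_add (by positivity) (by positivity), Finset.sum_insert hj]
    gcongr
    apply le_of_eq
    ring

end BoundedVariation

/-! ### Summability over the lattice -/

section LatticeSums

variable {d : ℕ}

theorem summable_pi_prod {f : Fin d → ℤ → ℝ} (h0 : ∀ i n, 0 ≤ f i n) (hf : ∀ i, Summable (f i)) :
    Summable fun k : Fin d → ℤ => ∏ i, f i (k i) := by
  classical
  refine summable_of_sum_le (c := ∏ i, ∑' n, f i n) (fun k => Finset.prod_nonneg fun i _ => h0 i _)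
    fun s => ?_
  calc ∑ k ∈ s, ∏ i, f i (k i)
      ≤ ∑ k ∈ Fintype.piFinset fun i => s.image fun k => k i, ∏ i, f i (k i) := by
        refine Finset.sum_le_sum_of_subset_of_nonneg (fun k hk => ?_)
          fun k _ _ => Finset.prod_nonneg fun i _ => h0 i _
        exact Fintype.mem_piFinset.2 fun i => Finset.mem_image_of_mem _ hk
    _ = ∏ i, ∑ n ∈ s.image fun k => k i, f i n := (Finset.prod_univ_sum _ _).symm
    _ ≤ ∏ i, ∑' n, f i n :=
        Finset.prod_le_prod (fun i _ => Finset.sum_nonneg fun n _ => h0 i n)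
          fun i _ => (hf i).sum_le_tsum _ fun n _ => h0 i n

theorem summable_int_pow_mul_exp {β : ℝ} (hβ : 0 < β) (m : ℕ) :
    Summable fun n : ℤ => (|(n : ℝ)| + m) ^ m * Real.exp (-β * |(n : ℝ)|) := by
  have hnat : Summable fun n : ℕ => ((n : ℝ) + m) ^ m * Real.exp (-β * n) := by
    -- Replacing `n` by `n + m` in the exponential only costs the factor `e^{βm}`.
    have h1 := (summable_nat_add_iff m).2 (Real.summable_pow_mul_exp_neg_nat_mul m hβ)
    refine (h1.mul_left (Real.exp (β * m))).congr fun n => ?_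
    rw [mul_left_comm, ← Real.exp_add]
    push_cast
    ring_nf
  rw [summable_int_iff_summable_nat_and_neg]
  constructor <;> simpa using hnat

theorem cast_l1norm (k : Fin d → ℤ) : (l1norm k : ℝ) = ∑ i, |(k i : ℝ)| := by
  simp [l1norm]

theorem l1norm_neg (k : Fin d → ℤ) : l1norm (-k) = l1norm k := by
  simp [l1norm]

/-- The weight `∏ᵢ (|kᵢ| + mᵢ)^{mᵢ}` of polynomial growth. -/
def polyWeight (m : Fin d → ℕ) (k : Fin d → ℤ) : ℝ := ∏ i, (|(k i : ℝ)| + m i) ^ m i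

theorem summable_polyWeight_mul_exp {β : ℝ} (hβ : 0 < β) (m : Fin d → ℕ) :
    Summable fun k : Fin d → ℤ => polyWeight m k * Real.exp (-β * l1norm k) := by
  refine (summable_pi_prod (f := fun i n => (|(n : ℝ)| + m i) ^ m i * Real.exp (-β * |(n : ℝ)|))
    (fun i n => by positivity) fun i => summable_int_pow_mul_exp hβ (m i)).congr fun k => ?_
  rw [Finset.prod_mul_distrib, polyWeight, cast_l1norm, Finset.mul_sum, Real.exp_sum]

variable {u : (Fin d → ℤ) → ℝ} {C α : ℝ}

theorem ExpDecay.abs_neg_le (hu : ExpDecay u C α) (k : Fin d → ℤ) :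
    |u (-k)| ≤ C * Real.exp (-α * l1norm k) := by
  simpa [l1norm_neg] using hu.2.2 (-k)

theorem ExpDecay.summable_mul (hu : ExpDecay u C α) {q : (Fin d → ℤ) → ℝ} {K β : ℝ} (hβ : β < α)
    (m : Fin d → ℕ) (hq : ∀ k, |q k| ≤ K * polyWeight m k * Real.exp (β * l1norm k)) :
    Summable fun k => u (-k) * q k := by
  refine Summable.of_norm_bounded
    ((summable_polyWeight_mul_exp (sub_pos.2 hβ) m).mul_left (C * K)) fun k => ?_
  rw [norm_mul, Real.norm_eq_abs, Real.norm_eq_abs]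
  calc |u (-k)| * |q k| ≤ C * Real.exp (-α * l1norm k) *
        (K * polyWeight m k * Real.exp (β * l1norm k)) :=
        mul_le_mul (hu.abs_neg_le k) (hq k) (abs_nonneg _)
          (mul_nonneg hu.1.le (Real.exp_nonneg _))
    _ = C * K * (polyWeight m k * Real.exp (-(α - β) * l1norm k)) := by
        rw [show -(α - β) * (l1norm k : ℝ) = -α * l1norm k + β * l1norm k by ring, Real.exp_add]
        ring

end LatticeSums

/-! ### Derivatives of the generating function and the weights that make translates sum to a
constant -/

section GeneratingFunction

variable {d : ℕ} {u : (Fin d → ℤ) → ℝ} {C α : ℝ}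

/-- The product of falling factorials `∏ᵢ kᵢ (kᵢ - 1) ⋯ (kᵢ - mᵢ + 1)`. -/
def fallingProd (m : Fin d → ℕ) (k : Fin d → ℤ) : ℝ :=
  ∏ i, (descPochhammer ℝ (m i)).eval (k i : ℝ)

theorem abs_descPochhammer_eval_le (m : ℕ) (x : ℝ) :
    |(descPochhammer ℝ m).eval x| ≤ (|x| + m) ^ m := by
  have h : ∀ j, j ≤ m → |(descPochhammer ℝ j).eval x| ≤ (|x| + m) ^ j := by
    intro j
    induction j with
    | zero => simp
    | succ j ih =>
      intro hj
      rw [descPochhammer_succ_eval, abs_mul, pow_succ]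
      refine mul_le_mul (ih (by omega)) ?_ (abs_nonneg _) (by positivity)
      have h1 : (j : ℝ) ≤ m := by exact_mod_cast (by omega : j ≤ m)
      have h2 := abs_sub x (j : ℝ)
      rw [Nat.abs_cast] at h2
      linarith
  exact h m le_rfl

theorem abs_fallingProd_le (m : Fin d → ℕ) (k : Fin d → ℤ) :
    |fallingProd m k| ≤ polyWeight m k := by
  rw [fallingProd, Finset.abs_prod]
  exact Finset.prod_le_prod (fun _ _ => abs_nonneg _) fun i _ => abs_descPochhammer_eval_le _ _

/-- The `k`-th term of the series of the `m`-th derivative of the generating function. -/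
def derivTerm (u : (Fin d → ℤ) → ℝ) (m : Fin d → ℕ) (k : Fin d → ℤ) (z : Fin d → ℂ) : ℂ :=
  (u (-k) : ℂ) * ∏ i, (((descPochhammer ℝ (m i)).eval (k i : ℝ) : ℝ) : ℂ) * z i ^ (k i - m i)

/-- The annulus `e^{-r} < |w| < e^r`. -/
def annulus (r : ℝ) : Set ℂ := {w | Real.exp (-r) < ‖w‖ ∧ ‖w‖ < Real.exp r}

theorem isOpen_annulus (r : ℝ) : IsOpen (annulus r) :=
  (isOpen_lt continuous_const continuous_norm).inter (isOpen_lt continuous_norm continuous_const)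

theorem ne_zero_of_mem_annulus {r : ℝ} {w : ℂ} (hw : w ∈ annulus r) : w ≠ 0 :=
  norm_pos_iff.1 ((Real.exp_pos _).trans hw.1)

theorem norm_zpow_le_of_mem_annulus {r : ℝ} {w : ℂ} (hw : w ∈ annulus r) (n : ℤ) :
    ‖w ^ n‖ ≤ Real.exp (r * |(n : ℝ)|) := by
  have hpos : 0 < ‖w‖ := norm_pos_iff.2 (ne_zero_of_mem_annulus hw)
  rw [norm_zpow, ← Real.exp_log hpos, ← Real.rpow_intCast, ← Real.exp_mul, mul_comm,
    Real.exp_le_exp]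
  have h1 : Real.log ‖w‖ < r := (Real.log_lt_iff_lt_exp hpos).2 hw.2
  have h2 : -r < Real.log ‖w‖ := (Real.lt_log_iff_exp_lt hpos).2 hw.1
  have h3 : |Real.log ‖w‖| ≤ r := abs_le.2 ⟨h2.le, h1.le⟩
  calc (n : ℝ) * Real.log ‖w‖ ≤ |(n : ℝ) * Real.log ‖w‖| := le_abs_self _
    _ = |(n : ℝ)| * |Real.log ‖w‖| := abs_mul _ _
    _ ≤ |(n : ℝ)| * r := by gcongr
    _ = r * |(n : ℝ)| := mul_comm _ _

/-- Gives one summable majorant on the whole polyannulus when `r < α`, which is what allows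
differentiating term by term. An annulus is needed because negative powers occur. -/
theorem norm_derivTerm_le (hu : ExpDecay u C α) {r : ℝ} (hr : 0 ≤ r) (m : Fin d → ℕ)
    (k : Fin d → ℤ) {z : Fin d → ℂ} (hz : ∀ i, z i ∈ annulus r) :
    ‖derivTerm u m k z‖ ≤ C * Real.exp (r * ∑ i, (m i : ℝ)) *
      (polyWeight m k * Real.exp (-(α - r) * l1norm k)) := by
  have hprod : ‖∏ i, (((descPochhammer ℝ (m i)).eval (k i : ℝ) : ℝ) : ℂ) * z i ^ (k i - m i)‖ ≤
      polyWeight m k * Real.exp (r * ∑ i, (m i : ℝ) + r * l1norm k) := by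
    have : r * ∑ i, (m i : ℝ) + r * l1norm k = ∑ i, r * (|(k i : ℝ)| + m i) := by
      rw [cast_l1norm, ← Finset.mul_sum, Finset.sum_add_distrib]
      ring
    rw [this, Real.exp_sum, polyWeight, ← Finset.prod_mul_distrib, norm_prod]
    refine Finset.prod_le_prod (fun _ _ => norm_nonneg _) fun i _ => ?_
    rw [norm_mul, Complex.norm_real, Real.norm_eq_abs]
    refine mul_le_mul (abs_descPochhammer_eval_le _ _) ?_ (norm_nonneg _) (by positivity)
    refine (norm_zpow_le_of_mem_annulus (hz i) _).trans ?_
    gcongr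
    push_cast
    have h2 := abs_sub (k i : ℝ) (m i : ℝ)
    rwa [Nat.abs_cast] at h2
  rw [derivTerm, norm_mul, Complex.norm_real, Real.norm_eq_abs]
  calc _ ≤ C * Real.exp (-α * l1norm k) *
        (polyWeight m k * Real.exp (r * ∑ i, (m i : ℝ) + r * l1norm k)) :=
        mul_le_mul (hu.abs_neg_le k) hprod (norm_nonneg _)
          (mul_nonneg hu.1.le (Real.exp_nonneg _))
    _ = _ := by
        rw [show -(α - r) * (l1norm k : ℝ) = -α * l1norm k + r * l1norm k by ring, Real.exp_add,
          Real.exp_add]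
        ring

theorem derivTerm_update (u : (Fin d → ℤ) → ℝ) (m : Fin d → ℕ) (k : Fin d → ℤ) (z : Fin d → ℂ)
    (i : Fin d) (w : ℂ) :
    derivTerm u m k (Function.update z i w) =
      ((u (-k) : ℂ) * (∏ j ∈ Finset.univ.erase i,
        (((descPochhammer ℝ (m j)).eval (k j : ℝ) : ℝ) : ℂ) * z j ^ (k j - m j)) *
        (((descPochhammer ℝ (m i)).eval (k i : ℝ) : ℝ) : ℂ)) * w ^ (k i - m i) := by
  rw [derivTerm, ← Finset.mul_prod_erase _ _ (Finset.mem_univ i), Function.update_self]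
  rw [Finset.prod_congr rfl (g := fun j =>
    (((descPochhammer ℝ (m j)).eval (k j : ℝ) : ℝ) : ℂ) * z j ^ (k j - m j))]
  · ring
  · intro j hj
    rw [Function.update_of_ne (Finset.ne_of_mem_erase hj)]

theorem hasDerivAt_derivTerm (u : (Fin d → ℤ) → ℝ) (m : Fin d → ℕ) (k : Fin d → ℤ)
    (z : Fin d → ℂ) (i : Fin d) {w : ℂ} (hw : w ≠ 0) :
    HasDerivAt (fun w => derivTerm u m k (Function.update z i w))
      (derivTerm u (m + Pi.single i 1) k (Function.update z i w)) w := by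
  simp only [derivTerm_update]
  refine ((hasDerivAt_zpow (k i - m i) w (Or.inl hw)).const_mul _).congr_deriv ?_
  have hprod : ∏ j ∈ Finset.univ.erase i,
      (((descPochhammer ℝ ((m + Pi.single i 1 : Fin d → ℕ) j)).eval (k j : ℝ) : ℝ) : ℂ) *
        z j ^ (k j - ((m + Pi.single i 1 : Fin d → ℕ) j : ℕ)) = ∏ j ∈ Finset.univ.erase i,
      (((descPochhammer ℝ (m j)).eval (k j : ℝ) : ℝ) : ℂ) * z j ^ (k j - m j) :=
    Finset.prod_congr rfl fun j hj => by simp [Finset.ne_of_mem_erase hj]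
  rw [hprod]
  simp only [Pi.add_apply, Pi.single_eq_same, descPochhammer_succ_eval]
  push_cast
  rw [sub_sub]
  ring

theorem partialDeriv_tsum_derivTerm (hu : ExpDecay u C α) (m : Fin d → ℕ) (i : Fin d)
    {f : (Fin d → ℂ) → ℂ} (hf : ∀ z, (∀ j, z j ∈ annulus (α / 2)) → f z = ∑' k, derivTerm u m k z)
    {z : Fin d → ℂ} (hz : ∀ j, z j ∈ annulus (α / 2)) :
    partialDeriv i f z = ∑' k, derivTerm u (m + Pi.single i 1) k z := by
  have hα : 0 < α := hu.2.1
  have hmem : ∀ w ∈ annulus (α / 2), ∀ j, Function.update z i w j ∈ annulus (α / 2) := by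
    intro w hw j
    by_cases hj : j = i
    · subst hj
      simpa using hw
    · simpa [hj] using hz j
  have hsum := Complex.hasSum_deriv_of_summable_norm (U := annulus (α / 2))
    (F := fun k w => derivTerm u m k (Function.update z i w))
    ((summable_polyWeight_mul_exp (β := α - α / 2) (by linarith) m).mul_left
      (C * Real.exp (α / 2 * ∑ i, (m i : ℝ))))
    (fun k w hw => (hasDerivAt_derivTerm u m k z i
      (ne_zero_of_mem_annulus hw)).differentiableAt.differentiableWithinAt)
    (isOpen_annulus _)
    (fun k w hw => norm_derivTerm_le hu (by positivity) m k (hmem w hw)) (hz i)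
  rw [partialDeriv, Filter.EventuallyEq.deriv_eq (f := fun w => ∑' k, derivTerm u m k
    (Function.update z i w)), ← hsum.tsum_eq]
  · refine tsum_congr fun k => ?_
    rw [(hasDerivAt_derivTerm u m k z i (ne_zero_of_mem_annulus (hz i))).deriv,
      Function.update_eq_self]
  · filter_upwards [(isOpen_annulus (α / 2)).mem_nhds (hz i)] with w hw
    exact hf _ (hmem w hw)

theorem iterate_partialDeriv_tsum_derivTerm (hu : ExpDecay u C α) (m : Fin d → ℕ) (i : Fin d)
    {f : (Fin d → ℂ) → ℂ} (hf : ∀ z, (∀ j, z j ∈ annulus (α / 2)) → f z = ∑' k, derivTerm u m k z)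
    (n : ℕ) : ∀ z, (∀ j, z j ∈ annulus (α / 2)) →
      (partialDeriv i)^[n] f z = ∑' k, derivTerm u (m + Pi.single i n) k z := by
  induction n with
  | zero => simpa using hf
  | succ n ih =>
    intro z hz
    rw [Function.iterate_succ_apply', partialDeriv_tsum_derivTerm hu _ i ih hz, add_assoc,
      ← Pi.single_add]

theorem multiDeriv_genFun (hu : ExpDecay u C α) (m : Fin d → ℕ) {z : Fin d → ℂ}
    (hz : ∀ j, z j ∈ annulus (α / 2)) :
    multiDeriv m (genFun u) z = ∑' k, derivTerm u m k z := by
  -- For a general list the order in the `j`-th variable is `m j` times the number of occurrences of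
  -- `j`; in `List.finRange d` each index occurs once.
  have h : ∀ L : List (Fin d), ∀ z : Fin d → ℂ, (∀ j, z j ∈ annulus (α / 2)) →
      L.foldr (fun i g => (partialDeriv i)^[m i] g) (genFun u) z =
        ∑' k, derivTerm u (fun j => L.count j * m j) k z := by
    intro L
    induction L with
    | nil =>
      intro z _
      simp [genFun, derivTerm]
    | cons i L ih =>
      intro z hz
      rw [List.foldr_cons, iterate_partialDeriv_tsum_derivTerm hu _ i ih (m i) z hz]
      refine tsum_congr fun k => ?_
      congr 1
      funext j
      by_cases hj : j = i
      · subst hj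
        simp [add_mul]
      · simp [hj, List.count_cons_of_ne (Ne.symm hj)]
  rw [multiDeriv, h _ z hz]
  refine tsum_congr fun k => ?_
  congr 1
  funext j
  rw [List.count_eq_one_of_mem (List.nodup_finRange d) (List.mem_finRange j), one_mul]

theorem summable_mul_fallingProd (hu : ExpDecay u C α) (m : Fin d → ℕ) :
    Summable fun k => u (-k) * fallingProd m k :=
  hu.summable_mul (K := 1) hu.2.1 m fun k => by
    simpa using abs_fallingProd_le m k

theorem derivAtOne_eq (hu : ExpDecay u C α) (m : Fin d → ℕ) :
    derivAtOne u m = ((∑' k, u (-k) * fallingProd m k : ℝ) : ℂ) := by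
  have hα := hu.2.1
  rw [derivAtOne, multiDeriv_genFun hu m, Complex.ofReal_tsum]
  · refine tsum_congr fun k => ?_
    simp [derivTerm, fallingProd]
  · intro j
    simp [annulus, hα]

theorem exists_pow_eq_sum_descPochhammer (n : ℕ) (x : ℝ) :
    ∃ b : ℕ → ℝ, b n = 1 ∧ ∀ y : ℝ, (x + y) ^ n =
      ∑ j ∈ Finset.range (n + 1), b j * (descPochhammer ℝ j).eval y := by
  induction n with
  | zero => exact ⟨fun _ => 1, rfl, fun y => by simp⟩
  | succ n ih =>
    obtain ⟨b, hb, h⟩ := ih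
    -- Write `x + y = (x + j) + (y - j)`: the first summand keeps the `j`-th falling factorial
    -- (`b'`), the second raises it to the next one (`b''`). The cutoff `j ≤ n` discards the values
    -- of `b` that are not controlled.
    let b' : ℕ → ℝ := fun j => if j ≤ n then b j * (x + j) else 0
    let b'' : ℕ → ℝ := fun j => if j = 0 then 0 else b (j - 1)
    refine ⟨fun j => b' j + b'' j, by simp [b', b'', hb], fun y => ?_⟩
    simp only [add_mul, Finset.sum_add_distrib]
    rw [Finset.sum_range_succ (fun j => b' j * _), Finset.sum_range_succ' (fun j => b'' j * _)]
    have h1 : b' (n + 1) = 0 := by simp [b']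
    have h2 : b'' 0 = 0 := by simp [b'']
    rw [h1, h2, zero_mul, zero_mul, add_zero, add_zero, ← Finset.sum_add_distrib, pow_succ, h y,
      Finset.sum_mul]
    refine Finset.sum_congr rfl fun j hj => ?_
    have h3 : b' j = b j * (x + j) := if_pos (Nat.lt_succ_iff.1 (Finset.mem_range.1 hj))
    have h4 : b'' (j + 1) = b j := by simp [b'']
    rw [h3, h4, descPochhammer_succ_eval]
    ring

/-- A shifted monomial is a combination of falling factorials with leading coefficient `1`. -/
theorem exists_prod_pow_eq_sum_fallingProd (m : Fin d → ℕ) (x : Fin d → ℤ) :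
    ∃ b : (Fin d → ℕ) → ℝ, b m = 1 ∧ ∀ k : Fin d → ℤ, ∏ i, (((x + k) i : ℤ) : ℝ) ^ m i =
      ∑ J ∈ Finset.Iic m, b J * fallingProd J k := by
  choose b hb h using fun i => exists_pow_eq_sum_descPochhammer (m i) (x i : ℝ)
  refine ⟨fun J => ∏ i, b i (J i), by simp [hb], fun k => ?_⟩
  have hset : Finset.Iic m = Fintype.piFinset fun i => Finset.range (m i + 1) := by
    ext J
    simp [Pi.le_def]
  rw [hset]
  simp only [Pi.add_apply, Int.cast_add, h, Finset.prod_univ_sum, fallingProd,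
    Finset.prod_mul_distrib]

/-- In the expansion into falling factorials all terms with `J < m` sum to zero and the leading
coefficient is `1`, so the sum does not depend on `x`. With `c = 0` and `x = 0` it also turns
vanishing derivatives into vanishing moments. -/
theorem tsum_mul_prod_pow (hu : ExpDecay u C α) (m : Fin d → ℕ) (x : Fin d → ℤ) {c : ℝ}
    (hm : ∑' k, u (-k) * fallingProd m k = c)
    (hlow : ∀ J < m, ∑' k, u (-k) * fallingProd J k = 0) :
    HasSum (fun k => u (-k) * ∏ i, (((x + k) i : ℤ) : ℝ) ^ m i) c := by
  obtain ⟨b, hb, h⟩ := exists_prod_pow_eq_sum_fallingProd m x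
  have hsum : HasSum (fun k => ∑ J ∈ Finset.Iic m, b J * (u (-k) * fallingProd J k))
      (∑ J ∈ Finset.Iic m, b J * ∑' k, u (-k) * fallingProd J k) :=
    hasSum_sum fun J _ => (summable_mul_fallingProd hu J).hasSum.mul_left _
  have hval : ∑ J ∈ Finset.Iic m, b J * ∑' k, u (-k) * fallingProd J k = c := by
    rw [Finset.sum_eq_single_of_mem m (Finset.mem_Iic.2 le_rfl), hb, one_mul, hm]
    intro J hJ hne
    rw [hlow J (lt_of_le_of_ne (Finset.mem_Iic.1 hJ) hne), mul_zero]
  rw [hval] at hsum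
  refine hsum.congr_fun fun k => ?_
  rw [h, Finset.mul_sum]
  exact Finset.sum_congr rfl fun J _ => by ring

/-- The leading index `m` gives the monomial weights `k^m` with which translates of `u` sum up to
the constant `c_u`. -/
theorem IsLeadingIndex.hasSum (hu : ExpDecay u C α) {m : Fin d → ℕ} (hm : IsLeadingIndex u m) :
    ∃ c : ℝ, c ≠ 0 ∧ derivAtOne u m = c ∧
      ∀ x, HasSum (fun k : Fin d → ℤ => (∏ i, (k i : ℝ) ^ m i) * u (x - k)) c := by
  refine ⟨∑' k, u (-k) * fallingProd m k, ?_, derivAtOne_eq hu m, fun x => ?_⟩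
  · have := hm.1
    rw [derivAtOne_eq hu m] at this
    exact_mod_cast this
  · have h := tsum_mul_prod_pow hu m x rfl fun J hJ => by
      have := hm.2 J hJ
      rw [derivAtOne_eq hu J] at this
      exact_mod_cast this
    rw [← (Equiv.addLeft x).hasSum_iff]
    refine h.congr_fun fun k => ?_
    simp only [Function.comp_apply, Equiv.coe_addLeft]
    rw [show x - (x + k) = -k by abel, mul_comm]

end GeneratingFunction

/-! ### Existence and finiteness of leading indices -/

section MomentProblem

open ProbabilityTheory

/-- Moments determine the characteristic function if exponential moments exist. -/
theorem complexMGF_eq_of_moments_eq {Ω : Type*} [MeasurableSpace Ω] {X : Ω → ℝ}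
    {μ ν : Measure Ω} (hμ : 0 ∈ interior (integrableExpSet X μ))
    (hν : 0 ∈ interior (integrableExpSet X ν))
    (h : ∀ n : ℕ, ∫ ω, X ω ^ n ∂μ = ∫ ω, X ω ^ n ∂ν) :
    complexMGF X μ Complex.I = complexMGF X ν Complex.I := by
  have hderiv : ∀ n, iteratedDeriv n (complexMGF X μ) 0 = iteratedDeriv n (complexMGF X ν) 0 := by
    intro n
    rw [iteratedDeriv_complexMGF (by simpa using hμ), iteratedDeriv_complexMGF (by simpa using hν)]
    simp only [zero_mul, Complex.exp_zero, mul_one]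
    have h' := congrArg (fun t : ℝ => (t : ℂ)) (h n)
    simp only [← integral_complex_ofReal] at h'
    exact_mod_cast h'
  have hloc : complexMGF X μ =ᶠ[nhds 0] complexMGF X ν := by
    have h1 := (analyticAt_complexMGF (z := 0) (by simpa using hμ)).hasFPowerSeriesAt
    have h2 := (analyticAt_complexMGF (z := 0) (by simpa using hν)).hasFPowerSeriesAt
    simp only [hderiv] at h1
    have h3 := h1.sub h2
    rw [sub_self] at h3
    filter_upwards [h3.eventually_eq_zero] with z hz
    exact sub_eq_zero.1 hz
  -- Equal Taylor coefficients give equality only near `0`; this vertical strip is connected, lies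
  -- in both domains of analyticity and contains `I`.
  let U : Set ℂ := {z | z.re ∈ interior (integrableExpSet X μ) ∩ interior (integrableExpSet X ν)}
  have hU : IsPreconnected U :=
    ((convex_integrableExpSet.interior.inter convex_integrableExpSet.interior).linear_preimage
      Complex.reLm).isPreconnected
  exact AnalyticOnNhd.eqOn_of_preconnected_of_eventuallyEq (U := U) (z₀ := 0)
    (analyticOnNhd_complexMGF.mono fun z hz => hz.1)
    (analyticOnNhd_complexMGF.mono fun z hz => hz.2) hU (by simpa [U] using ⟨hμ, hν⟩) hloc
    (by simpa [U] using ⟨hμ, hν⟩)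

variable {d : ℕ}

/-- For small `|t|` the factor `e^{t⟨k, θ⟩}` grows at most like `e^{α‖k‖₁/2}` and uses up only half
of the decay. Taking `Θ + 1` instead of `Θ` keeps the denominator positive when `θ = 0`. -/
theorem zero_mem_interior_integrableExpSet {C α : ℝ} (hα : 0 < α) {p : (Fin d → ℤ) → NNReal}
    (hp : ∀ k, (p k : ℝ) ≤ C * Real.exp (-α * l1norm k)) (θ : Fin d → ℝ) :
    0 ∈ interior (integrableExpSet (fun k : Fin d → ℤ => ∑ i, (k i : ℝ) * θ i)
      (Measure.count.withDensity fun k => (p k : ENNReal))) := by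
  set Θ := ∑ i, |θ i| with hΘ
  have hΘ0 : 0 ≤ Θ := Finset.sum_nonneg fun _ _ => abs_nonneg _
  have hr : 0 < α / (2 * (Θ + 1)) := by positivity
  rw [mem_interior]
  refine ⟨Set.Ioo (-(α / (2 * (Θ + 1)))) (α / (2 * (Θ + 1))), fun t ht => ?_, isOpen_Ioo,
    by simpa using hr⟩
  rw [integrableExpSet, Set.mem_ofPred_eq,
    integrable_withDensity_iff_integrable_smul (measurable_of_countable p), integrable_count_iff]
  refine Summable.of_nonneg_of_le (fun _ => norm_nonneg _) (fun k => ?_)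
    ((summable_polyWeight_mul_exp (d := d) (β := α / 2) (by positivity) 0).mul_left C)
  have hX : t * ∑ i, (k i : ℝ) * θ i ≤ α / 2 * l1norm k := by
    have h1 : |∑ i, (k i : ℝ) * θ i| ≤ (Θ + 1) * l1norm k := by
      rw [cast_l1norm, Finset.mul_sum]
      refine (Finset.abs_sum_le_sum_abs _ _).trans (Finset.sum_le_sum fun i _ => ?_)
      rw [abs_mul, mul_comm]
      gcongr
      have := Finset.single_le_sum (f := fun i => |θ i|) (fun _ _ => abs_nonneg _)
        (Finset.mem_univ i)
      linarith
    have h2 : |t| ≤ α / (2 * (Θ + 1)) := (abs_lt.2 ht).le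
    calc t * ∑ i, (k i : ℝ) * θ i ≤ |t| * |∑ i, (k i : ℝ) * θ i| := by
          rw [← abs_mul]; exact le_abs_self _
      _ ≤ α / (2 * (Θ + 1)) * ((Θ + 1) * l1norm k) := by gcongr
      _ = α / 2 * l1norm k := by field_simp
  rw [NNReal.smul_def, smul_eq_mul, Real.norm_eq_abs, abs_mul, NNReal.abs_eq, Real.abs_exp]
  calc (p k : ℝ) * Real.exp (t * ∑ i, (k i : ℝ) * θ i)
      ≤ C * Real.exp (-α * l1norm k) * Real.exp (α / 2 * l1norm k) := by
        gcongr
        · exact (NNReal.coe_nonneg _).trans (hp k)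
        · exact hp k
    _ = C * (polyWeight 0 k * Real.exp (-(α / 2) * l1norm k)) := by
        rw [mul_assoc, ← Real.exp_add]
        simp only [polyWeight, Pi.zero_apply, pow_zero, Finset.prod_const_one, one_mul]
        ring_nf

theorem isFiniteMeasure_of_zero_mem {Ω : Type*} [MeasurableSpace Ω] {X : Ω → ℝ} {μ : Measure Ω}
    (h : 0 ∈ integrableExpSet X μ) : IsFiniteMeasure μ := by
  have h1 : Integrable (fun _ : Ω => (1 : ℝ)) μ := by simpa [integrableExpSet] using h
  exact ((integrable_const_iff (c := (1 : ℝ))).1 h1).resolve_left one_ne_zero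

/-- The weights are read as two measures on `ℤ^d`. For each `θ` the moments of `⟨k, θ⟩` are
combinations of the multivariate ones, so the one-dimensional result identifies the characteristic
functions at `θ`. The embedding into Euclidean space is injective, so equality of the image measures
gives equality of the weights. -/
theorem ext_of_moments_eq {C α : ℝ} (hα : 0 < α) {p q : (Fin d → ℤ) → NNReal}
    (hp : ∀ k, (p k : ℝ) ≤ C * Real.exp (-α * l1norm k))
    (hq : ∀ k, (q k : ℝ) ≤ C * Real.exp (-α * l1norm k))
    (h : ∀ m : Fin d → ℕ, HasSum (fun k => ((p k : ℝ) - q k) * ∏ i, (k i : ℝ) ^ m i) 0) :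
    p = q := by
  set μ := (Measure.count : Measure (Fin d → ℤ)).withDensity fun k => (p k : ENNReal) with hμ
  set ν := (Measure.count : Measure (Fin d → ℤ)).withDensity fun k => (q k : ENNReal) with hν
  have hpm : Measurable p := measurable_of_countable p
  have hqm : Measurable q := measurable_of_countable q
  have : IsFiniteMeasure μ :=
    isFiniteMeasure_of_zero_mem (interior_subset (zero_mem_interior_integrableExpSet hα hp 0))
  have : IsFiniteMeasure ν :=
    isFiniteMeasure_of_zero_mem (interior_subset (zero_mem_interior_integrableExpSet hα hq 0))
  have hmom : ∀ (θ : Fin d → ℝ) (n : ℕ), ∫ k, (∑ i, (k i : ℝ) * θ i) ^ n ∂μ =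
      ∫ k, (∑ i, (k i : ℝ) * θ i) ^ n ∂ν := by
    intro θ n
    have h1 := integrable_pow_of_mem_interior_integrableExpSet
      (zero_mem_interior_integrableExpSet hα hp θ) n
    have h2 := integrable_pow_of_mem_interior_integrableExpSet
      (zero_mem_interior_integrableExpSet hα hq θ) n
    rw [integrable_withDensity_iff_integrable_smul hpm] at h1
    rw [integrable_withDensity_iff_integrable_smul hqm] at h2
    rw [hμ, hν, integral_withDensity_eq_integral_smul hpm,
      integral_withDensity_eq_integral_smul hqm, ← sub_eq_zero, ← integral_sub h1 h2]
    have h3 := integral_countable (h1.sub h2)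
    simp only [Pi.sub_apply] at h3
    rw [h3]
    let P : MvPolynomial (Fin d) ℝ := (∑ i, MvPolynomial.X i * MvPolynomial.C (θ i)) ^ n
    have hP : ∀ k : Fin d → ℤ, (∑ i, (k i : ℝ) * θ i) ^ n =
        ∑ m ∈ P.support, P.coeff m * ∏ i, (k i : ℝ) ^ m i := by
      intro k
      rw [← MvPolynomial.eval_eq' (fun i => (k i : ℝ)) P]
      simp [P]
    have hsum : HasSum (fun k => ∑ m ∈ P.support,
        P.coeff m * (((p k : ℝ) - q k) * ∏ i, (k i : ℝ) ^ m i)) (∑ m ∈ P.support, P.coeff m * 0) :=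
      hasSum_sum fun m _ => (h m).mul_left _
    simp only [mul_zero, Finset.sum_const_zero] at hsum
    rw [← hsum.tsum_eq]
    refine tsum_congr fun k => ?_
    rw [measureReal_def, Measure.count_singleton]
    simp only [NNReal.smul_def, smul_eq_mul, hP, ENNReal.toReal_one, one_mul]
    rw [← sub_mul, Finset.mul_sum]
    exact Finset.sum_congr rfl fun m _ => by ring
  let e : (Fin d → ℤ) → EuclideanSpace ℝ (Fin d) := fun k => WithLp.toLp 2 fun i => (k i : ℝ)
  have he : Measurable e := measurable_of_countable e
  have he_inj : Function.Injective e := by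
    intro k k' hkk'
    funext i
    have := congrArg (fun v : EuclideanSpace ℝ (Fin d) => v i) hkk'
    simpa [e] using this
  have hmap : μ.map e = ν.map e := by
    refine Measure.ext_of_charFun (funext fun θ => ?_)
    have h1 := complexMGF_eq_of_moments_eq
      (zero_mem_interior_integrableExpSet hα hp fun i => θ i)
      (zero_mem_interior_integrableExpSet hα hq fun i => θ i) (hmom fun i => θ i)
    have h2 : ∀ k, inner ℝ (e k) θ = ∑ i, (k i : ℝ) * θ i := by
      intro k
      rw [PiLp.inner_apply]
      exact Finset.sum_congr rfl fun i _ => by simp [e, mul_comm]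
    rw [charFun_apply, charFun_apply, integral_map he.aemeasurable (by fun_prop),
      integral_map he.aemeasurable (by fun_prop)]
    simp only [h2]
    simpa only [complexMGF, mul_comm Complex.I] using h1
  funext k
  have h1 := congrArg (fun m : Measure _ => m {e k}) hmap
  simp only [Measure.map_apply he (measurableSet_singleton _)] at h1
  have h2 : e ⁻¹' {e k} = {k} := by
    ext k'
    simp [he_inj.eq_iff]
  rw [h2, hμ, hν, withDensity_apply _ (measurableSet_singleton _),
    withDensity_apply _ (measurableSet_singleton _), lintegral_singleton, lintegral_singleton,
    Measure.count_singleton] at h1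
  simpa using h1

variable {u : (Fin d → ℤ) → ℝ} {C α : ℝ}

/-- Moment determinacy concerns positive measures, so it is applied to the positive and negative
parts of `k ↦ u (-k)`. -/
theorem eq_zero_of_derivAtOne_eq_zero (hu : ExpDecay u C α) (h : ∀ m, derivAtOne u m = 0) :
    u = 0 := by
  have hfall : ∀ m, ∑' k, u (-k) * fallingProd m k = 0 := by
    intro m
    have := h m
    rw [derivAtOne_eq hu] at this
    exact_mod_cast this
  have hpq : ∀ k, ((u (-k)).toNNReal : ℝ) - ((-u (-k)).toNNReal : ℝ) = u (-k) := by
    intro k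
    rw [Real.coe_toNNReal', Real.coe_toNNReal', max_zero_sub_eq_self]
  have heq := ext_of_moments_eq (p := fun k => (u (-k)).toNNReal)
    (q := fun k => (-u (-k)).toNNReal) hu.2.1 (C := C)
    (fun k => by
      rw [Real.coe_toNNReal']
      exact (max_le (le_abs_self _) (abs_nonneg _)).trans (hu.abs_neg_le k))
    (fun k => by
      rw [Real.coe_toNNReal']
      exact (max_le (neg_le_abs _) (abs_nonneg _)).trans (hu.abs_neg_le k))
    (fun m => by
      simp only [hpq]
      simpa using tsum_mul_prod_pow hu m 0 (hfall m) fun J _ => hfall J)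
  funext k
  have h1 := hpq (-k)
  have h2 := congrFun heq (-k)
  rw [h2, sub_self, neg_neg] at h1
  exact h1.symm

theorem exists_isLeadingIndex (hu0 : u ≠ 0) (hu : ExpDecay u C α) :
    ∃ m, IsLeadingIndex u m := by
  have hne : {m | derivAtOne u m ≠ 0}.Nonempty := by
    by_contra hempty
    refine hu0 (eq_zero_of_derivAtOne_eq_zero hu fun m => ?_)
    by_contra hm
    exact hempty ⟨m, hm⟩
  obtain ⟨m, hm, hmin⟩ := WellFounded.has_min (wellFounded_lt (α := Fin d → ℕ)) _ hne
  refine ⟨m, hm, fun J hJ => ?_⟩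
  by_contra hJ0
  exact hmin J hJ0 hJ

/-- Two leading indices are never comparable, and antichains in `ℕ^d` are finite by Dickson's lemma.
-/
theorem finite_setOf_isLeadingIndex (u : (Fin d → ℤ) → ℝ) : {m | IsLeadingIndex u m}.Finite := by
  refine WellQuasiOrderedLE.finite_of_isAntichain fun a ha b hb hab hle => ?_
  exact ha.1 (hb.2 a (lt_of_le_of_ne hle hab))

end MomentProblem

/-! ### Truncating the weighted sum to the box of radius `R_l` -/

section Truncation

variable {d : ℕ} {u : (Fin d → ℤ) → ℝ} {C α : ℝ}

/-- The sup norm of a lattice point. -/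
def supNorm (k : Fin d → ℤ) : ℕ := Finset.univ.sup fun i => (k i).natAbs

theorem abs_le_supNorm (k : Fin d → ℤ) (i : Fin d) : |(k i : ℝ)| ≤ supNorm k := by
  have h : (k i).natAbs ≤ supNorm k :=
    Finset.le_sup (f := fun i => (k i).natAbs) (Finset.mem_univ i)
  rw [← Int.cast_abs, Int.abs_eq_natAbs]
  exact_mod_cast h

theorem exists_abs_eq_supNorm [NeZero d] (k : Fin d → ℤ) : ∃ i, |(k i : ℝ)| = supNorm k := by
  obtain ⟨i, -, hi⟩ := Finset.exists_mem_eq_sup Finset.univ Finset.univ_nonempty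
    fun i => (k i).natAbs
  refine ⟨i, ?_⟩
  rw [← Int.cast_abs, Int.abs_eq_natAbs, supNorm, hi]
  simp

theorem lt_supNorm_of_notMem_box {R : ℝ} {k : Fin d → ℤ} (hk : k ∉ box d R) :
    R < supNorm k := by
  by_contra h
  exact hk (mem_box.2 fun i => abs_le.1 ((abs_le_supNorm k i).trans (not_lt.1 h)))

theorem card_filter_supNorm_le (s : Finset (Fin d → ℤ)) (n : ℕ) :
    (s.filter fun k => supNorm k = n).card ≤ (2 * n + 1) ^ d := by
  calc (s.filter fun k => supNorm k = n).card
      ≤ (Fintype.piFinset fun _ : Fin d => Finset.Icc (-n : ℤ) n).card := by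
        refine Finset.card_le_card fun k hk => Fintype.mem_piFinset.2 fun i => ?_
        have h := abs_le_supNorm k i
        rw [(Finset.mem_filter.1 hk).2] at h
        rw [Finset.mem_Icc, ← abs_le]
        exact_mod_cast h
    _ = (2 * n + 1) ^ d := by
        rw [Fintype.card_piFinset_const, Int.card_Icc]
        congr 1
        omega

theorem log_le_sqrt {x : ℝ} (hx : 0 < x) : Real.log x ≤ √x := by
  have hs : 0 < √x := Real.sqrt_pos.2 hx
  have h1 := Real.log_le_sub_one_of_pos (half_pos hs)
  rw [Real.log_div hs.ne' two_ne_zero, Real.log_sqrt hx.le] at h1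
  have h2 := Real.log_two_lt_d9
  linarith

/-- This is what the second entry of the maximum in `radius` is for, with `M = d + N`: half of the
exponential decay absorbs all polynomial factors. -/
theorem pow_le_exp_half {M : ℕ} (hα : 0 < α) {n : ℝ} (hn : 0 < n)
    (h : 8 * (M : ℝ) ^ 2 / α ^ 2 ≤ n) : n ^ M ≤ Real.exp (α * n / 2) := by
  have hs : 2 * M / α ≤ √n := by
    refine Real.le_sqrt_of_sq_le (le_trans ?_ h)
    rw [div_pow]
    gcongr
    nlinarith [sq_nonneg (M : ℝ)]
  rw [div_le_iff₀ hα] at hs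
  rw [← Real.exp_log hn, ← Real.exp_nat_mul, Real.exp_le_exp, Real.exp_log hn]
  calc (M : ℝ) * Real.log n ≤ M * √n := by gcongr; exact log_le_sqrt hn
    _ ≤ α * (√n * √n) / 2 := by nlinarith [Real.sqrt_nonneg n]
    _ = α * n / 2 := by rw [Real.mul_self_sqrt hn.le]

theorem sum_pow_le_of_forall_le {q : ℝ} (hq0 : 0 ≤ q) (hq1 : q < 1) {T : Finset ℕ} {n₀ : ℕ}
    (hT : ∀ n ∈ T, n₀ ≤ n) : ∑ n ∈ T, q ^ n ≤ q ^ n₀ / (1 - q) := by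
  refine le_trans ?_ (geom_sum_Ico_le_of_lt_one (m := n₀) (n := T.sup id + 1) hq0 hq1)
  refine Finset.sum_le_sum_of_subset_of_nonneg (fun n hn => ?_) fun n _ _ => by positivity
  exact Finset.mem_Ico.2 ⟨hT n hn, Nat.lt_succ_of_le (Finset.le_sup (f := id) hn)⟩

theorem abs_prod_pow_le (m : Fin d → ℕ) (k : Fin d → ℤ) {Q : ℝ} (hk : ∀ i, |(k i : ℝ)| ≤ Q) :
    |∏ i, (k i : ℝ) ^ m i| ≤ Q ^ ∑ i, m i := by
  rw [Finset.abs_prod, ← Finset.prod_pow_eq_pow_sum]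
  refine Finset.prod_le_prod (fun _ _ => abs_nonneg _) fun i _ => ?_
  rw [abs_pow]
  exact pow_le_pow_left₀ (abs_nonneg _) (hk i) _

theorem abs_mul_le_of_supNorm [NeZero d] (hu : ExpDecay u C α) (m : Fin d → ℕ) {l : ℝ}
    {x : Fin d → ℤ} (hx : x ∈ box d l) (k : Fin d → ℤ) :
    |(∏ i, (k i : ℝ) ^ m i) * u (x - k)| ≤
      (supNorm k : ℝ) ^ (∑ i, m i) * (C * Real.exp (-α * (supNorm k - l))) := by
  rw [abs_mul]
  have hC := hu.1
  have hα := hu.2.1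
  refine mul_le_mul (abs_prod_pow_le m k (abs_le_supNorm k)) ?_ (abs_nonneg _) (by positivity)
  refine (hu.2.2 _).trans ?_
  have h : (supNorm k : ℝ) - l ≤ l1norm (x - k) := by
    obtain ⟨i, hi⟩ := exists_abs_eq_supNorm k
    have h1 : |((x - k) i : ℤ)| ≤ l1norm (x - k) :=
      Finset.single_le_sum (f := fun j => |(x - k) j|) (fun j _ => abs_nonneg _)
        (Finset.mem_univ i)
    have h2 : |(x i : ℝ) - k i| ≤ l1norm (x - k) := by exact_mod_cast h1
    have h3 : |(x i : ℝ)| ≤ l := abs_le.2 (mem_box.1 hx i)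
    have h4 := abs_sub_abs_le_abs_sub (k i : ℝ) (x i)
    rw [abs_sub_comm] at h4
    linarith
  rw [neg_mul, neg_mul]
  gcongr

/-- Outside the box of the radius `radius u C α m l` only half of the sum remains. -/
theorem sum_abs_le_of_disjoint_box (hu : ExpDecay u C α) {m : Fin d → ℕ}
    (hm : derivAtOne u m ≠ 0) {l : ℝ} {x : Fin d → ℤ} (hx : x ∈ box d l)
    {s : Finset (Fin d → ℤ)} (hs : ∀ k ∈ s, k ∉ box d (radius u C α m l)) :
    ∑ k ∈ s, |(∏ i, (k i : ℝ) ^ m i) * u (x - k)| ≤ ‖derivAtOne u m‖ / 2 := by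
  -- In dimension zero the box is the whole lattice and there is no tail.
  obtain rfl | hd := Nat.eq_zero_or_pos d
  · have : s = ∅ := Finset.eq_empty_of_forall_notMem fun k hk =>
      hs k hk (mem_box.2 fun i => i.elim0)
    rw [this, Finset.sum_empty]
    positivity
  have : NeZero d := ⟨hd.ne'⟩
  have hC := hu.1
  have hα := hu.2.1
  set c := ‖derivAtOne u m‖ with hc
  have hcpos : 0 < c := norm_pos_iff.2 hm
  set q := Real.exp (-α / 2) with hq
  have hq1 : q < 1 := Real.exp_zero ▸ Real.exp_lt_exp.2 (by linarith)
  set R := radius u C α m l with hR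
  set X := 2 * 3 ^ d * C / (c * (1 - q)) with hX
  have hq1' : 0 < 1 - q := by linarith
  have hXpos : 0 < X := by positivity
  have hR1 : 2 * l + 2 / α * Real.log X ≤ R := le_max_left _ _
  have hR2 : 8 * ((d + ∑ i, m i : ℕ) : ℝ) ^ 2 / α ^ 2 ≤ R := by
    push_cast
    refine le_trans (le_of_eq ?_) (le_max_right _ _)
    push_cast
    rfl
  have hdpos : (0 : ℝ) < ((d + ∑ i, m i : ℕ) : ℝ) := by exact_mod_cast (by omega)
  have hRpos : 0 < R := lt_of_lt_of_le (by positivity) hR2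
  -- The contribution of the shell of sup norm `n`: at most `(2n+1)^d ≤ (3n)^d` points, each with
  -- weight at most `n^N`. The remaining half of the decay is `q ^ n`.
  have hterm : ∀ n : ℕ, R < n → (2 * n + 1 : ℝ) ^ d *
      ((n : ℝ) ^ (∑ i, m i) * (C * Real.exp (-α * (n - l)))) ≤
      3 ^ d * C * Real.exp (α * l) * q ^ n := by
    intro n hn
    have hn0 : (0 : ℝ) < n := hRpos.trans hn
    have hn1 : (1 : ℝ) ≤ n := by exact_mod_cast Nat.cast_pos.1 hn0
    have h1 := pow_le_exp_half hα hn0 (hR2.trans hn.le)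
    calc (2 * n + 1 : ℝ) ^ d * ((n : ℝ) ^ (∑ i, m i) * (C * Real.exp (-α * (n - l))))
        ≤ (3 * n : ℝ) ^ d * ((n : ℝ) ^ (∑ i, m i) * (C * Real.exp (-α * (n - l)))) := by
          gcongr
          linarith
      _ = 3 ^ d * C * ((n : ℝ) ^ (d + ∑ i, m i) * Real.exp (-α * (n - l))) := by
          rw [mul_pow, pow_add]
          ring
      _ ≤ 3 ^ d * C * (Real.exp (α * n / 2) * Real.exp (-α * (n - l))) := by gcongr
      _ = 3 ^ d * C * Real.exp (α * l) * q ^ n := by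
          rw [hq, ← Real.exp_nat_mul, ← Real.exp_add, mul_assoc (3 ^ d * C), ← Real.exp_add]
          ring_nf
  -- Here the first entry of the maximum enters: it makes the geometric tail, with its prefactor,
  -- exactly `c / 2`.
  have hexp : Real.exp (α * l) * q ^ ⌈R⌉₊ ≤ X⁻¹ := by
    rw [hq, ← Real.exp_nat_mul, ← Real.exp_add, ← Real.exp_log hXpos, ← Real.exp_neg,
      Real.exp_le_exp]
    have h1 : α / 2 * (2 * l + 2 / α * Real.log X) ≤ α / 2 * ⌈R⌉₊ := by
      gcongr
      exact hR1.trans (Nat.le_ceil R)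
    have h2 : α / 2 * (2 * l + 2 / α * Real.log X) = α * l + Real.log X := by field_simp
    linarith
  have hlt : ∀ k ∈ s, R < supNorm k := fun k hk => lt_supNorm_of_notMem_box (hs k hk)
  calc ∑ k ∈ s, |(∏ i, (k i : ℝ) ^ m i) * u (x - k)|
      ≤ ∑ k ∈ s, (supNorm k : ℝ) ^ (∑ i, m i) * (C * Real.exp (-α * (supNorm k - l))) :=
        Finset.sum_le_sum fun k _ => abs_mul_le_of_supNorm hu m hx k
    _ = ∑ n ∈ s.image supNorm, ∑ k ∈ s with supNorm k = n,
          (supNorm k : ℝ) ^ (∑ i, m i) * (C * Real.exp (-α * (supNorm k - l))) :=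
        (Finset.sum_fiberwise_of_maps_to (fun k hk => Finset.mem_image_of_mem _ hk) _).symm
    _ ≤ ∑ n ∈ s.image supNorm, 3 ^ d * C * Real.exp (α * l) * q ^ n := by
        refine Finset.sum_le_sum fun n hn => ?_
        obtain ⟨k, hk, rfl⟩ := Finset.mem_image.1 hn
        refine le_trans ?_ (hterm _ (hlt k hk))
        rw [Finset.sum_congr rfl (g := fun _ => (supNorm k : ℝ) ^ (∑ i, m i) *
          (C * Real.exp (-α * (supNorm k - l)))) fun k' hk' => by
            rw [(Finset.mem_filter.1 hk').2], Finset.sum_const, nsmul_eq_mul]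
        gcongr
        exact_mod_cast card_filter_supNorm_le s (supNorm k)
    _ = 3 ^ d * C * Real.exp (α * l) * ∑ n ∈ s.image supNorm, q ^ n := by rw [Finset.mul_sum]
    _ ≤ 3 ^ d * C * Real.exp (α * l) * (q ^ ⌈R⌉₊ / (1 - q)) := by
        gcongr
        refine sum_pow_le_of_forall_le (Real.exp_nonneg _) hq1 fun n hn => ?_
        obtain ⟨k, hk, rfl⟩ := Finset.mem_image.1 hn
        exact Nat.ceil_le.2 (hlt k hk).le
    _ = 3 ^ d * C / (1 - q) * (Real.exp (α * l) * q ^ ⌈R⌉₊) := by ring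
    _ ≤ 3 ^ d * C / (1 - q) * X⁻¹ := by gcongr
    _ = c / 2 := by
        rw [hX]
        field_simp

theorem abs_sum_box_sub_le (hu : ExpDecay u C α) {m : Fin d → ℕ} (hm : derivAtOne u m ≠ 0)
    {c : ℝ} (hc : derivAtOne u m = c) {l : ℝ} {x : Fin d → ℤ} (hx : x ∈ box d l)
    (hsum : HasSum (fun k : Fin d → ℤ => (∏ i, (k i : ℝ) ^ m i) * u (x - k)) c) :
    |∑ k ∈ box d (radius u C α m l), (∏ i, (k i : ℝ) ^ m i) * u (x - k) - c| ≤ |c| / 2 := by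
  classical
  set B := box d (radius u C α m l)
  have hnorm : ‖derivAtOne u m‖ = |c| := by rw [hc, Complex.norm_real, Real.norm_eq_abs]
  have hlim : Filter.Tendsto
      (fun s => |∑ k ∈ B, (∏ i, (k i : ℝ) ^ m i) * u (x - k) -
        ∑ k ∈ s, (∏ i, (k i : ℝ) ^ m i) * u (x - k)|) Filter.atTop
      (nhds |∑ k ∈ B, (∏ i, (k i : ℝ) ^ m i) * u (x - k) - c|) :=
    (tendsto_const_nhds.sub hsum).abs
  refine le_of_tendsto hlim ?_
  filter_upwards [Filter.eventually_ge_atTop B] with s hs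
  rw [abs_sub_comm, ← Finset.sum_sdiff hs, add_sub_cancel_right, ← hnorm]
  refine (Finset.abs_sum_le_sum_abs _ _).trans (sum_abs_le_of_disjoint_box hu hm hx fun k hk => ?_)
  exact (Finset.mem_sdiff.1 hk).2

end Truncation

/-! ### From shifted couplings to the Wegner estimate -/

section Operators

variable {d : ℕ} {u ω : (Fin d → ℤ) → ℝ} {Λ Γ : Finset (Fin d → ℤ)}

theorem boxHamiltonian_apply (u ω : (Fin d → ℤ) → ℝ) (Λ : Finset (Fin d → ℤ))
    (ψ : EuclideanSpace ℂ Λ) (x : Λ) :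
    boxHamiltonian u ω Λ ψ x = ((neighbors (x : Fin d → ℤ)).card : ℂ) * ψ x -
      (∑ y : Λ, if (y : Fin d → ℤ) ∈ neighbors (x : Fin d → ℤ) then ψ y else 0) +
      (potential u ω x : ℂ) * ψ x := by
  have h1 : ∀ y : Λ, inclusion Λ ψ y = ψ y := fun y => by simp [inclusion]
  have h2 : ∑ y ∈ neighbors (x : Fin d → ℤ), inclusion Λ ψ y =
      ∑ y : Λ, if (y : Fin d → ℤ) ∈ neighbors (x : Fin d → ℤ) then ψ y else 0 := by
    simp only [← h1]
    rw [Finset.sum_coe_sort Λ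
      fun y => if y ∈ neighbors (x : Fin d → ℤ) then inclusion Λ ψ y else 0, Finset.sum_ite_mem]
    refine (Finset.sum_subset Finset.inter_subset_right fun y hy hy' => ?_).symm
    have : y ∉ Λ := fun h => hy' (Finset.mem_inter.2 ⟨h, hy⟩)
    simp [inclusion, this]
  rw [← h2]
  change laplacian d (inclusion Λ ψ) x + (potential u ω x : ℂ) * inclusion Λ ψ x = _
  rw [h1]
  congr 1
  change ∑ y ∈ neighbors (x : Fin d → ℤ), (inclusion Λ ψ x - inclusion Λ ψ y) = _
  rw [Finset.sum_sub_distrib, Finset.sum_const, nsmul_eq_mul, h1]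

theorem mem_neighbors_comm {x y : Fin d → ℤ} : y ∈ neighbors x ↔ x ∈ neighbors y := by
  rw [mem_neighbors, mem_neighbors, ← l1norm_neg, neg_sub]

theorem isSymmetric_boxHamiltonian (u ω : (Fin d → ℤ) → ℝ) (Λ : Finset (Fin d → ℤ)) :
    (boxHamiltonian u ω Λ).IsSymmetric := by
  intro ψ φ
  simp only [PiLp.inner_apply, RCLike.inner_apply, boxHamiltonian_apply]
  simp only [map_add, map_sub, map_mul, map_sum, mul_add, mul_sub, add_mul, sub_mul,
    Finset.sum_add_distrib, Finset.sum_sub_distrib, Finset.mul_sum, Finset.sum_mul]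
  congr 1
  · congr 1
    · refine Finset.sum_congr rfl fun x _ => ?_
      simp only [map_natCast]
      ring
    · rw [Finset.sum_comm]
      refine Finset.sum_congr rfl fun x _ => Finset.sum_congr rfl fun y _ => ?_
      by_cases h : (x : Fin d → ℤ) ∈ neighbors (y : Fin d → ℤ)
      · simp [h, mem_neighbors_comm.1 h]
      · simp [h, mt mem_neighbors_comm.1 h]
  · refine Finset.sum_congr rfl fun x _ => ?_
    simp only [Complex.conj_ofReal]
    ring

theorem re_inner_boxHamiltonian_sub (u ω ω' : (Fin d → ℤ) → ℝ) (Λ : Finset (Fin d → ℤ))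
    (ψ : EuclideanSpace ℂ Λ) :
    (inner ℂ ψ (boxHamiltonian u ω' Λ ψ)).re - (inner ℂ ψ (boxHamiltonian u ω Λ ψ)).re =
      ∑ x : Λ, (potential u ω' x - potential u ω x) * ‖ψ x‖ ^ 2 := by
  rw [← Complex.sub_re, ← inner_sub_right, PiLp.inner_apply, Complex.re_sum]
  refine Finset.sum_congr rfl fun x _ => ?_
  rw [PiLp.sub_apply, boxHamiltonian_apply, boxHamiltonian_apply, add_sub_add_left_eq_sub,
    ← sub_mul, RCLike.inner_apply, mul_assoc, Complex.mul_conj, ← Complex.ofReal_sub,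
    ← Complex.ofReal_mul, Complex.ofReal_re, Complex.normSq_eq_norm_sq]

/-- Only finitely many couplings change, so the series stays summable and the potential is affine in
`η`. -/
theorem potential_glue (hω : ∀ x, Summable fun k => ω k * u (x - k)) (η : Γ → ℝ)
    (x : Fin d → ℤ) :
    potential u (glue Γ η ω) x = potential u ω x + ∑ k : Γ, (η k - ω k) * u (x - k) := by
  have hfin : HasSum (fun k => if hk : k ∈ Γ then (η ⟨k, hk⟩ - ω k) * u (x - k) else 0)
      (∑ k ∈ Γ, if hk : k ∈ Γ then (η ⟨k, hk⟩ - ω k) * u (x - k) else 0) :=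
    hasSum_sum_of_ne_finset_zero fun k hk => by simp [hk]
  have h := (hω x).hasSum.add hfin
  rw [potential, potential]
  refine (h.congr_fun fun k => ?_).tsum_eq.trans ?_
  · by_cases hk : k ∈ Γ
    · simp only [glue, hk, dif_pos]
      ring
    · simp [glue, hk]
  · congr 1
    rw [← Finset.sum_coe_sort Γ]
    exact Finset.sum_congr rfl fun k _ => by simp

theorem traceProj_eq (u ω : (Fin d → ℤ) → ℝ) (Λ : Finset (Fin d → ℤ)) (B : Set ℝ) :
    traceProj u ω Λ B = spectralCount (boxHamiltonian u ω Λ) B := by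
  rw [traceProj, trace_spectralProjection]
  simp

theorem measurable_spectralCount_glue (hω : ∀ x, Summable fun k => ω k * u (x - k)) {B : Set ℝ}
    (hB : MeasurableSet B) :
    Measurable fun η : Γ → ℝ => spectralCount (boxHamiltonian u (glue Γ η ω) Λ) B := by
  refine measurable_spectralCount (fun η => isSymmetric_boxHamiltonian u _ Λ) (fun η ε hε => ?_) hB
  have hcont : ∀ x : Λ, Continuous fun η : Γ → ℝ => potential u (glue Γ η ω) x := by
    intro x
    simp only [potential_glue hω]
    fun_prop
  have h : ∀ᶠ η' in nhds η, ∀ x : Λ,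
      potential u (glue Γ η' ω) x < potential u (glue Γ η ω) x + ε := by
    rw [Filter.eventually_all]
    intro x
    exact (hcont x).continuousAt.eventually_lt continuousAt_const (by linarith)
  filter_upwards [h] with η' hη' ψ
  rw [← sub_le_iff_le_add', re_inner_boxHamiltonian_sub, EuclideanSpace.norm_sq_eq, Finset.mul_sum]
  refine Finset.sum_le_sum fun x _ => ?_
  gcongr
  linarith [hη' x]

/-- If shifting the couplings along `a` raises the potential by at least `δ` on `Λ`, then the
eigenvalues move by at least the corresponding amount. -/
theorem spectralCount_glue_add_le (hω : ∀ x, Summable fun k => ω k * u (x - k)) {a : Γ → ℝ}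
    {δ : ℝ} (hδ : 0 < δ) (ha : ∀ x ∈ Λ, δ ≤ ∑ k : Γ, a k * u (x - k)) {e₁ e₂ : ℝ}
    (he : e₁ ≤ e₂) {B : Set ℝ} (hB : B ⊆ Set.Ico e₁ e₂) (η : Γ → ℝ) :
    spectralCount (boxHamiltonian u (glue Γ η ω) Λ) B +
      spectralCount (boxHamiltonian u (glue Γ (η + ((e₂ - e₁) / δ) • a) ω) Λ) (Set.Iio e₂) ≤
      spectralCount (boxHamiltonian u (glue Γ η ω) Λ) (Set.Iio e₂) := by
  refine le_trans (Nat.add_le_add_left ?_ _)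
    (spectralCount_add_le (isSymmetric_boxHamiltonian u _ Λ) he hB)
  -- The shift raises the form by at least `e₂ - e₁`, so there are at most as many eigenvalues below
  -- `e₂` after it as below `e₁` before.
  refine spectralCount_Iio_le_of_form_le (isSymmetric_boxHamiltonian u _ Λ)
    (isSymmetric_boxHamiltonian u _ Λ) fun ψ => ?_
  rw [← le_sub_iff_add_le', re_inner_boxHamiltonian_sub, EuclideanSpace.norm_sq_eq, Finset.mul_sum]
  refine Finset.sum_le_sum fun x _ => mul_le_mul_of_nonneg_right ?_ (by positivity)
  rw [potential_glue hω, potential_glue hω, add_sub_add_left_eq_sub, ← Finset.sum_sub_distrib]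
  have h1 : ∀ k : Γ, ((η + ((e₂ - e₁) / δ) • a) k - ω k) * u (x - k) -
      (η k - ω k) * u (x - k) = (e₂ - e₁) / δ * (a k * u (x - k)) := by
    intro k
    simp only [Pi.add_apply, Pi.smul_apply, smul_eq_mul]
    ring
  simp only [h1]
  rw [← Finset.mul_sum]
  calc e₂ - e₁ = (e₂ - e₁) / δ * δ := by field_simp
    _ ≤ _ := mul_le_mul_of_nonneg_left (ha x x.2) (div_nonneg (sub_nonneg.2 he) hδ.le)

theorem spectralCount_boxHamiltonian_le (u ω : (Fin d → ℤ) → ℝ) (Λ : Finset (Fin d → ℤ))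
    (B : Set ℝ) : spectralCount (boxHamiltonian u ω Λ) B ≤ Λ.card := by
  simpa using spectralCount_le (boxHamiltonian u ω Λ) B

variable {μ : Measure ℝ} [IsProbabilityMeasure μ] {ρ : ℝ → ℝ}

theorem integrable_traceProj (hω : ∀ x, Summable fun k => ω k * u (x - k)) {B : Set ℝ}
    (hB : MeasurableSet B) :
    Integrable (fun η : Γ → ℝ => traceProj u (glue Γ η ω) Λ B) (Measure.pi fun _ : Γ => μ) := by
  simp only [traceProj_eq]
  refine Integrable.of_bound (measurable_from_top.comp
    (measurable_spectralCount_glue hω hB)).aestronglyMeasurable Λ.card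
    (Filter.Eventually.of_forall fun η => ?_)
  simp only [Real.norm_eq_abs, Nat.abs_cast, Nat.cast_le]
  exact spectralCount_boxHamiltonian_le _ _ _ _

theorem integral_traceProj_le_of_subset_Ico (hμ : HasDensity μ ρ) (hρ : IsBV ρ)
    (hω : ∀ x, Summable fun k => ω k * u (x - k)) {a : Γ → ℝ}
    {δ : ℝ} (hδ : 0 < δ) (ha : ∀ x ∈ Λ, δ ≤ ∑ k : Γ, a k * u (x - k)) {e₁ e₂ : ℝ}
    (he : e₁ ≤ e₂) {B : Set ℝ} (hBm : MeasurableSet B) (hB : B ⊆ Set.Ico e₁ e₂) :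
    ∫ η : Γ → ℝ, traceProj u (glue Γ η ω) Λ B ∂(Measure.pi fun _ : Γ => μ) ≤
      Λ.card * ((e₂ - e₁) / δ * ∑ k, |a k|) * varNorm ρ := by
  set P := Measure.pi fun _ : Γ => μ
  set t := (e₂ - e₁) / δ with ht
  have ht0 : 0 ≤ t := div_nonneg (sub_nonneg.2 he) hδ.le
  have hV := varNorm_nonneg hρ
  let G : (Γ → ℝ) → ℝ := fun η => spectralCount (boxHamiltonian u (glue Γ η ω) Λ) (Set.Iio e₂)
  have hG : Measurable G :=
    measurable_from_top.comp (measurable_spectralCount_glue hω measurableSet_Iio)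
  have hG0 : ∀ η, 0 ≤ G η := fun η => Nat.cast_nonneg _
  have hGM : ∀ η, G η ≤ Λ.card := fun η =>
    Nat.cast_le.2 (spectralCount_boxHamiltonian_le _ _ _ _)
  have hshift := lintegral_pi_le_lintegral_shift hμ hρ hG hG0 hGM (t • a)
  have hsum : ∑ k, |(t • a) k| = t * ∑ k, |a k| := by
    simp only [Pi.smul_apply, smul_eq_mul, abs_mul, abs_of_nonneg ht0, Finset.mul_sum]
  rw [hsum] at hshift
  have hle : ∫⁻ η, ENNReal.ofReal (traceProj u (glue Γ η ω) Λ B) ∂P +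
      ∫⁻ η, ENNReal.ofReal (G (η + t • a)) ∂P ≤ ∫⁻ η, ENNReal.ofReal (G η) ∂P := by
    rw [← lintegral_add_right]
    · refine lintegral_mono fun η => ?_
      rw [traceProj_eq, ← ENNReal.ofReal_add (Nat.cast_nonneg _) (hG0 _)]
      refine ENNReal.ofReal_le_ofReal ?_
      have := spectralCount_glue_add_le hω hδ ha he hB η
      simp only [G]
      exact_mod_cast this
    · exact (hG.comp (measurable_add_const _)).ennreal_ofReal
  -- Finiteness is needed to cancel the shifted count from both sides of the inequality.
  have hfin : ∫⁻ η, ENNReal.ofReal (G (η + t • a)) ∂P ≠ ⊤ := by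
    refine ne_of_lt (lt_of_le_of_lt (lintegral_mono fun η => ENNReal.ofReal_le_ofReal (hGM _)) ?_)
    simp [P]
  have hmain : ∫⁻ η, ENNReal.ofReal (traceProj u (glue Γ η ω) Λ B) ∂P ≤
      ENNReal.ofReal (Λ.card * (t * ∑ k, |a k|) * varNorm ρ) := by
    refine (ENNReal.add_le_add_iff_right hfin).1 (hle.trans (hshift.trans (le_of_eq ?_)))
    rw [add_comm]
  rw [integral_eq_lintegral_of_nonneg_ae
    (Filter.Eventually.of_forall fun η => by simp [traceProj_eq])
    (integrable_traceProj hω hBm).aestronglyMeasurable]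
  refine ENNReal.toReal_le_of_le_ofReal ?_ hmain
  have : 0 ≤ ∑ k, |a k| := Finset.sum_nonneg fun _ _ => abs_nonneg _
  positivity

/-- A Wegner estimate for couplings which can be shifted so that the potential increases. -/
theorem integral_traceProj_le (hμ : HasDensity μ ρ) (hρ : IsBV ρ)
    (hω : ∀ x, Summable fun k => ω k * u (x - k)) {a : Γ → ℝ}
    {δ : ℝ} (hδ : 0 < δ) (ha : ∀ x ∈ Λ, δ ≤ ∑ k : Γ, a k * u (x - k)) {I : Set ℝ}
    (hI : I.OrdConnected) (hIb : Bornology.IsBounded I) :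
    ∫ η : Γ → ℝ, traceProj u (glue Γ η ω) Λ I ∂(Measure.pi fun _ : Γ => μ) ≤
      Λ.card * (volume.real I / δ * ∑ k, |a k|) * varNorm ρ := by
  rcases I.eq_empty_or_nonempty with rfl | hne
  · simpa using integral_traceProj_le_of_subset_Ico hμ hρ hω hδ ha (le_refl (0 : ℝ))
      MeasurableSet.empty (Set.empty_subset _)
  have hbelow := hIb.bddBelow
  have habove := hIb.bddAbove
  have hvol : sSup I - sInf I ≤ volume.real I := by
    have hsub : Set.Ioo (sInf I) (sSup I) ⊆ I :=
      IsConnected.Ioo_csInf_csSup_subset ⟨hne, hI.isPreconnected⟩ hbelow habove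
    have h1 := measureReal_mono (μ := volume) hsub hIb.measure_lt_top.ne
    rwa [Real.volume_real_Ioo_of_le (csInf_le_csSup hne hbelow habove)] at h1
  have hV := varNorm_nonneg hρ
  set S := ∑ k, |a k| with hS
  have hS0 : 0 ≤ S := Finset.sum_nonneg fun _ _ => abs_nonneg _
  have hlim : Filter.Tendsto
      (fun ε : ℝ => (Λ.card : ℝ) * ((volume.real I + ε) / δ * S) * varNorm ρ)
      (nhdsWithin 0 (Set.Ioi 0))
      (nhds (Λ.card * ((volume.real I + 0) / δ * S) * varNorm ρ)) := by
    refine Filter.Tendsto.mono_left ?_ nhdsWithin_le_nhds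
    exact Continuous.tendsto (by fun_prop) 0
  rw [add_zero] at hlim
  refine ge_of_tendsto hlim ?_
  filter_upwards [self_mem_nhdsWithin] with ε hε
  have hε' : 0 < ε := hε
  -- The interval may contain its right endpoint, so the half-open interval is enlarged by `ε`,
  -- which tends to zero.
  have hsub : I ⊆ Set.Ico (sInf I) (sSup I + ε) := fun y hy =>
    ⟨csInf_le hbelow hy, lt_of_le_of_lt (le_csSup habove hy) (by linarith)⟩
  have hle : sInf I ≤ sSup I + ε := by linarith [csInf_le_csSup hne hbelow habove]
  refine (integral_traceProj_le_of_subset_Ico hμ hρ hω hδ ha hle hI.measurableSet hsub).trans ?_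
  gcongr
  linarith

end Operators

/-! ### Uniformity of the constant -/

section Constants

variable {d : ℕ} {u : (Fin d → ℤ) → ℝ} {C α : ℝ}

theorem card_box_le {l : ℝ} (hl : 0 ≤ l) : ((box d l).card : ℝ) ≤ (2 * l + 1) ^ d := by
  rw [box, Fintype.card_piFinset_const, Int.card_Icc, Nat.cast_pow]
  refine pow_le_pow_left₀ (Nat.cast_nonneg _) ?_ _
  have h0 : 0 ≤ ⌊l⌋ := Int.floor_nonneg.2 hl
  have h1 : (((⌊l⌋ + 1 - ⌈-l⌉).toNat : ℤ) : ℝ) = 2 * ⌊l⌋ + 1 := by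
    rw [Int.toNat_of_nonneg (by rw [Int.ceil_neg]; omega), Int.ceil_neg]
    push_cast
    ring
  rw [Int.cast_natCast] at h1
  rw [h1]
  linarith [Int.floor_le l]

theorem box_mono {R R' : ℝ} (h : R ≤ R') : box d R ⊆ box d R' := fun _ hk =>
  mem_box.2 fun i => ⟨by linarith [(mem_box.1 hk i).1], by linarith [(mem_box.1 hk i).2]⟩

theorem sum_box_abs_prod_pow_le (m : Fin d → ℕ) {R Q : ℝ} (hRQ : R ≤ Q) (hQ : 0 ≤ Q) :
    ∑ k ∈ box d R, |∏ i, (k i : ℝ) ^ m i| ≤ (2 * Q + 1) ^ d * Q ^ ∑ i, m i := by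
  calc ∑ k ∈ box d R, |∏ i, (k i : ℝ) ^ m i|
      ≤ ∑ k ∈ box d Q, |∏ i, (k i : ℝ) ^ m i| :=
        Finset.sum_le_sum_of_subset_of_nonneg (box_mono hRQ) fun _ _ _ => abs_nonneg _
    _ ≤ ∑ k ∈ box d Q, Q ^ ∑ i, m i :=
        Finset.sum_le_sum fun k hk => abs_prod_pow_le m k fun i => abs_le.2 (mem_box.1 hk i)
    _ = (box d Q).card * Q ^ ∑ i, m i := by rw [Finset.sum_const, nsmul_eq_mul]
    _ ≤ _ := by
        gcongr
        exact card_box_le hQ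

theorem exists_radius_le (u : (Fin d → ℤ) → ℝ) (C α : ℝ) (m : Fin d → ℕ) :
    ∃ K : ℝ, 1 ≤ K ∧ ∀ l : ℝ, 0 ≤ l → radius u C α m l ≤ K * (2 * l + 1) := by
  set A := 2 / α * Real.log (2 * 3 ^ d * C / (‖derivAtOne u m‖ * (1 - Real.exp (-α / 2))))
    with hA
  set B := 8 * ((d : ℝ) + (∑ i, m i : ℕ)) ^ 2 / α ^ 2 with hB
  refine ⟨1 + |A| + |B|, by linarith [abs_nonneg A, abs_nonneg B], fun l hl => ?_⟩
  have h1 : 0 ≤ |A| * l := by positivity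
  have h2 : 0 ≤ |B| * l := by positivity
  have h3 := abs_nonneg A
  have h4 := abs_nonneg B
  rw [radius, ← hA, ← hB]
  refine max_le ?_ ?_
  · nlinarith [le_abs_self A]
  · nlinarith [le_abs_self B]

/-- The weights `± k^m`, cut off outside the smaller of two admissible boxes, make the translates
of `u` sum up to at least `|c_u| / 2` on `Λ_l`. -/
theorem half_le_sum_weights {C₀ α₀ : ℝ} (hu : ExpDecay u C α) (hu₀ : ExpDecay u C₀ α₀)
    {m : Fin d → ℕ} (hm : derivAtOne u m ≠ 0) {c : ℝ} (hc0 : c ≠ 0) (hc : derivAtOne u m = c)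
    (hsum : ∀ x, HasSum (fun k : Fin d → ℤ => (∏ i, (k i : ℝ) ^ m i) * u (x - k)) c)
    {l : ℝ} {x : Fin d → ℤ} (hx : x ∈ box d l) :
    |c| / 2 ≤ ∑ k : box d (radius u C α m l),
      (if (k : Fin d → ℤ) ∈ box d (radius u C₀ α₀ m l) then
        c / |c| * ∏ i, ((k : Fin d → ℤ) i : ℝ) ^ m i else 0) * u (x - k) := by
  rw [Finset.sum_coe_sort (box d (radius u C α m l)) fun k =>
    (if k ∈ box d (radius u C₀ α₀ m l) then c / |c| * ∏ i, (k i : ℝ) ^ m i else 0) * u (x - k)]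
  simp only [ite_mul, zero_mul]
  rw [Finset.sum_ite_mem]
  -- Concentric boxes are nested, so the intersection is one of the two, and the truncation bound
  -- holds for either pair of decay constants.
  have hcut : |∑ k ∈ box d (radius u C α m l) ∩ box d (radius u C₀ α₀ m l),
      (∏ i, (k i : ℝ) ^ m i) * u (x - k) - c| ≤ |c| / 2 := by
    rcases le_total (radius u C α m l) (radius u C₀ α₀ m l) with h | h
    · rw [Finset.inter_eq_left.2 (box_mono h)]
      exact abs_sum_box_sub_le hu hm hc hx (hsum x)
    · rw [Finset.inter_eq_right.2 (box_mono h)]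
      exact abs_sum_box_sub_le hu₀ hm hc hx (hsum x)
  simp only [mul_assoc]
  rw [← Finset.mul_sum]
  set S := ∑ k ∈ box d (radius u C α m l) ∩ box d (radius u C₀ α₀ m l),
      (∏ i, (k i : ℝ) ^ m i) * u (x - k)
  rw [abs_le] at hcut
  rcases lt_or_gt_of_ne hc0 with h | h
  · rw [abs_of_neg h] at hcut ⊢
    rw [show c / -c = -1 by field_simp]
    linarith [hcut.2]
  · rw [abs_of_pos h] at hcut ⊢
    rw [div_self hc0]
    linarith [hcut.1]

/-- The weights vanish outside the box of the fixed pair `C₀`, `α₀`. Their sum, and with it `W`, is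
thus bounded independently of `C` and `α`, however large `Γ` is. -/
theorem wegner_estimate_of_isLeadingIndex {C₀ α₀ : ℝ} (hu₀ : ExpDecay u C₀ α₀) {m : Fin d → ℕ}
    (hm : IsLeadingIndex u m) :
    ∃ W : ℝ, 0 < W ∧ ∀ (C α : ℝ), ExpDecay u C α →
      ∀ (μ : Measure ℝ) [IsProbabilityMeasure μ] (ρ : ℝ → ℝ), HasDensity μ ρ → IsBV ρ →
      ∀ (l : ℝ), 0 < l → ∀ (I : Set ℝ), I.OrdConnected → Bornology.IsBounded I →
      ∀ (ω : (Fin d → ℤ) → ℝ), (∀ x, Summable fun k => ω k * u (x - k)) →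
        ∫ η : box d (radius u C α m l) → ℝ,
          traceProj u (glue (box d (radius u C α m l)) η ω) (box d l) I
            ∂(Measure.pi fun _ : box d (radius u C α m l) => μ) ≤
          W * varNorm ρ * volume.real I * (2 * l + 1) ^ (2 * d + ∑ i, m i) := by
  obtain ⟨c, hc0, hc, hsum⟩ := hm.hasSum hu₀
  obtain ⟨K, hK1, hK⟩ := exists_radius_le u C₀ α₀ m
  have hcpos : 0 < |c| := abs_pos.2 hc0
  -- `2 / |c|` comes from `δ = |c| / 2`, and `3 * K` from `2Q + 1 ≤ 3Q` with `Q = K (2l + 1) ≥ 1`.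
  refine ⟨2 / |c| * ((3 * K) ^ d * K ^ ∑ i, m i), by positivity, ?_⟩
  intro C α hu μ _ ρ hμ hρ l hl I hI hIb ω hω
  have hV := varNorm_nonneg hρ
  refine (integral_traceProj_le hμ hρ hω (half_pos hcpos) (fun x hx =>
    half_le_sum_weights hu hu₀ hm.1 hc0 hc hsum hx) hI hIb).trans ?_
  have hL : 1 ≤ 2 * l + 1 := by linarith
  have hQ : 1 ≤ K * (2 * l + 1) := one_le_mul_of_one_le_of_one_le hK1 hL
  have hweights : ∑ k : box d (radius u C α m l),
      |if (k : Fin d → ℤ) ∈ box d (radius u C₀ α₀ m l) then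
        c / |c| * ∏ i, ((k : Fin d → ℤ) i : ℝ) ^ m i else 0| ≤
      (3 * K) ^ d * K ^ (∑ i, m i) * (2 * l + 1) ^ (d + ∑ i, m i) := by
    rw [Finset.sum_coe_sort (box d (radius u C α m l)) fun k =>
      |if k ∈ box d (radius u C₀ α₀ m l) then c / |c| * ∏ i, (k i : ℝ) ^ m i else 0|]
    have habs : ∀ k : Fin d → ℤ,
        |if k ∈ box d (radius u C₀ α₀ m l) then c / |c| * ∏ i, (k i : ℝ) ^ m i else 0| =
        if k ∈ box d (radius u C₀ α₀ m l) then |∏ i, (k i : ℝ) ^ m i| else 0 := by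
      intro k
      split_ifs
      · rw [abs_mul, abs_div, abs_abs, div_self hcpos.ne', one_mul]
      · exact abs_zero
    simp only [habs]
    rw [Finset.sum_ite_mem]
    calc ∑ k ∈ box d (radius u C α m l) ∩ box d (radius u C₀ α₀ m l), |∏ i, (k i : ℝ) ^ m i|
        ≤ ∑ k ∈ box d (radius u C₀ α₀ m l), |∏ i, (k i : ℝ) ^ m i| :=
          Finset.sum_le_sum_of_subset_of_nonneg Finset.inter_subset_right
            fun _ _ _ => abs_nonneg _
      _ ≤ (2 * (K * (2 * l + 1)) + 1) ^ d * (K * (2 * l + 1)) ^ ∑ i, m i :=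
          sum_box_abs_prod_pow_le m (hK l hl.le) (by linarith)
      _ ≤ (3 * (K * (2 * l + 1))) ^ d * (K * (2 * l + 1)) ^ ∑ i, m i := by
          gcongr
          linarith
      _ = _ := by
          rw [mul_pow K, ← mul_assoc 3 K, mul_pow (3 * K), pow_add]
          ring
  calc _ ≤ (2 * l + 1) ^ d * (volume.real I / (|c| / 2) * ((3 * K) ^ d * K ^ (∑ i, m i) *
        (2 * l + 1) ^ (d + ∑ i, m i))) * varNorm ρ := by
        gcongr
        exact card_box_le hl.le
    _ = _ := by
        rw [two_mul d, add_assoc d d, pow_add _ d (d + _)]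
        field_simp

end Constants

end AlloyWegner

end

theorem theorem2p3 {d : ℕ} (u : (Fin d → ℤ) → ℝ) (hu : u ≠ 0) (hdecay : ∃ C α, ExpDecay u C α) :
    (∃ I₀, IsLeadingIndex u I₀) ∧
    ∃ C_W : ℝ, 0 < C_W ∧
      ∀ (C α : ℝ) (I₀ : Fin d → ℕ), ExpDecay u C α → IsLeadingIndex u I₀ →
      ∀ (μ : Measure ℝ) [IsProbabilityMeasure μ] (ρ : ℝ → ℝ),
        Bornology.IsBounded μ.support → HasDensity μ ρ → IsBV ρ →
      ∀ (l : ℝ), 0 < l →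
      ∀ (I : Set ℝ), I.OrdConnected → Bornology.IsBounded I →
      -- the couplings outside `Γ` are fixed, and arbitrary as long as `v_ω` is defined
      ∀ (ω : (Fin d → ℤ) → ℝ), (∀ x, Summable fun k => ω k * u (x - k)) →
      ∀ (Γ : Finset (Fin d → ℤ)), Γ = box d (radius u C α I₀ l) →
        Integrable (fun η : Γ → ℝ => traceProj u (glue Γ η ω) (box d l) I)
          (Measure.pi fun _ : Γ => μ) ∧
        ∫ η : Γ → ℝ, traceProj u (glue Γ η ω) (box d l) I ∂(Measure.pi fun _ : Γ => μ) ≤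
          C_W * varNorm ρ * volume.real I * (2 * l + 1) ^ (2 * d + ∑ i, I₀ i) := by
  obtain ⟨C₀, α₀, hu₀⟩ := hdecay
  refine ⟨exists_isLeadingIndex hu hu₀, ?_⟩
  have hfin := finite_setOf_isLeadingIndex u
  choose! W hWpos hW using fun m (hm : IsLeadingIndex u m) =>
    wegner_estimate_of_isLeadingIndex hu₀ hm
  have hWnonneg : ∀ m ∈ hfin.toFinset, 0 ≤ W m := fun m hm =>
    (hWpos m (hfin.mem_toFinset.1 hm)).le
  -- The sum over the finitely many leading indices dominates each of their constants.
  refine ⟨1 + ∑ m ∈ hfin.toFinset, W m, by linarith [Finset.sum_nonneg hWnonneg], ?_⟩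
  intro C α I₀ hdec hI₀ μ _ ρ _ hμ hρ l hl I hI hIb ω hω Γ hΓ
  subst hΓ
  refine ⟨integrable_traceProj hω hI.measurableSet, ?_⟩
  refine (hW I₀ hI₀ C α hdec μ ρ hμ hρ l hl I hI hIb ω hω).trans ?_
  have hV := varNorm_nonneg hρ
  have hle : W I₀ ≤ ∑ m ∈ hfin.toFinset, W m :=
    Finset.single_le_sum hWnonneg (hfin.mem_toFinset.2 hI₀)
  gcongr
  linarith
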